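/- A \emph{uniform QPT algorithm} is a family of quantum circuits $(C_\lambda)_{\lambda\in\mathbb N}$ over a fixed finite universal gate set (here $H$, $T$, CNOT and Toffoli), with ancilla qubits initialised to $|0\rangle$ and some of the qubits traced out at the end, such that a deterministic Turing machine computes a description of $C_\lambda$ from $1^\lambda$ in time polynomial in $\lambda$. For a function $\ell:\mathbb N\to\mathbb N$, an \emph{$\ell(\lambda)$-qubit EFI} is a uniform QPT algorithm $\mathsf{StateGen}(b,1^\lambda)\to\rho_b$ that, on input a bit $b\in\{0,1\}$ and the security parameter $\lambda$, outputs an $\ell(\lambda)$-qubit (mixed) state $\rho_b=\rho_{b,\lambda}$ such that 1. (computational indistinguishability) for every uniform QPT adversary $\mathcal A$ with one-bit output, $\bigl|\Pr[1\gets\mathcal A(1^\lambda,\rho_0)]-\Pr[1\gets\mathcal A(1^\lambda,\rho_1)]\bigr|$ is negligible, i.e. $O(\lambda^{-c})$ for every $c\in\mathbb N$; 2. (statistical distinguishability) there is a polynomial $p$ such that $p(\lambda)>0$ and $\tfrac12\|\rho_0-\rho_1\|_1\ge 1/p(\lambda)$ for all sufficiently large $\lambda$. **Theorem.** There do not exist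 $O(\log\lambda)$-qubit EFIs: if $\ell(\lambda)=O(\log\lambda)$, then no uniform QPT algorithm is an $\ell(\lambda)$-qubit EFI. -/

import Mathlib

open Filter Asymptotics

noncomputable section

namespace QEFI

/-! ### Quantum circuits over the gate set `{H, T, CNOT, Toffoli}` -/

/-- The gates, acting on wires from `ι`. The wires of a multi-qubit gate are distinct. -/
inductive Gate (ι : Type) : Type
  | h (i : ι) : Gate ι
  | t (i : ι) : Gate ι
  | cnot (c i : ι) (hci : c ≠ i) : Gate ι
  | toffoli (c d i : ι) (hcd : c ≠ d) (hci : c ≠ i) (hdi : d ≠ i) : Gate ι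

section Matrices

variable {ι : Type} [Fintype ι] [DecidableEq ι]

/-- The single-qubit operator `u` applied to wire `i` (tensored with the identity on the other
wires), in the computational basis `ι → Bool`. -/
def onWire (u : Matrix Bool Bool ℂ) (i : ι) : Matrix (ι → Bool) (ι → Bool) ℂ :=
  Matrix.of fun x y => if ∀ j, j ≠ i → x j = y j then u (x i) (y i) else 0

/-- The operator `|y⟩ ↦ |f y⟩`. -/
def ofBasisMap (f : (ι → Bool) → (ι → Bool)) : Matrix (ι → Bool) (ι → Bool) ℂ :=
  Matrix.of fun x y => if x = f y then 1 else 0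

/-- `H = (1/√2) [[1, 1], [1, -1]]`. -/
def hGate : Matrix Bool Bool ℂ :=
  Matrix.of fun a b => (if a && b then -1 else 1) / (Real.sqrt 2 : ℂ)

/-- `T = diag(1, e^{iπ/4})`. -/
def tGate : Matrix Bool Bool ℂ :=
  Matrix.diagonal fun a => if a then Complex.exp (Complex.I * Real.pi / 4) else 1

/-- The unitary matrix of a gate. -/
def Gate.matrix : Gate ι → Matrix (ι → Bool) (ι → Bool) ℂ
  | .h i => onWire hGate i
  | .t i => onWire tGate i
  | .cnot c i _ => ofBasisMap fun x => Function.update x i (xor (x i) (x c))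
  | .toffoli c d i _ _ _ => ofBasisMap fun x => Function.update x i (xor (x i) (x c && x d))

end Matrices

/-- A quantum circuit with `m` input qubits and `n` output qubits. It has `wires ≥ m, n` wires:
the input is placed on the first `m` of them and all the others are initialised to `|0⟩`; the
gates are applied from left to right; the output is what is on the first `n` wires,
the others being traced out. -/
structure Circuit (m n : ℕ) where
  wires : ℕ
  in_le : m ≤ wires
  out_le : n ≤ wires
  gates : List (Gate (Fin wires))

namespace Circuit

variable {m n : ℕ}

/-- The unitary computed by the gates. -/
def unitary (C : Circuit m n) : Matrix (Fin C.wires → Bool) (Fin C.wires → Bool) ℂ :=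
  C.gates.foldl (fun U g => g.matrix * U) 1

/-- The isometry `|a⟩ ↦ |a⟩|0…0⟩`. -/
def prepare (C : Circuit m n) : Matrix (Fin C.wires → Bool) (Fin m → Bool) ℂ :=
  Matrix.of fun x a =>
    if (∀ i, x (Fin.castLE C.in_le i) = a i) ∧ ∀ j : Fin C.wires, m ≤ j.val → x j = false
    then 1 else 0

/-- The partial trace over all wires but the first `n`. -/
def discard (C : Circuit m n) (M : Matrix (Fin C.wires → Bool) (Fin C.wires → Bool) ℂ) :
    Matrix (Fin n → Bool) (Fin n → Bool) ℂ :=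
  Matrix.of fun a b => ∑ x, ∑ y,
    if (∀ i, x (Fin.castLE C.out_le i) = a i) ∧ (∀ i, y (Fin.castLE C.out_le i) = b i) ∧
      ∀ j : Fin C.wires, n ≤ j.val → x j = y j
    then M x y else 0

/-- The output state of the circuit on the `m`-qubit input state `ρ`. -/
def run (C : Circuit m n) (ρ : Matrix (Fin m → Bool) (Fin m → Bool) ℂ) :
    Matrix (Fin n → Bool) (Fin n → Bool) ℂ :=
  C.discard (C.unitary * C.prepare * ρ * (C.unitary * C.prepare).conjTranspose)

/-- The probability that measuring the single output qubit gives `1`. -/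
def acceptProb (C : Circuit m 1) (ρ : Matrix (Fin m → Bool) (Fin m → Bool) ℂ) : ℝ :=
  (C.run ρ (fun _ => true) (fun _ => true)).re

end Circuit

/-! ### Descriptions of circuits as strings -/

/-- The alphabet in which circuits are described. -/
inductive Sym : Type
  | one | sep | h | t | cnot | toffoli
  deriving DecidableEq

instance : Fintype Sym :=
  ⟨{.one, .sep, .h, .t, .cnot, .toffoli}, fun x => by cases x <;> decide⟩

/-- The number `k` in unary, followed by a separator. -/
def encodeNum (k : ℕ) : List Sym := List.replicate k Sym.one ++ [Sym.sep]

/-- The description of a gate: its name and the numbers of its wires. -/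
def Gate.encode {w : ℕ} : Gate (Fin w) → List Sym
  | .h i => Sym.h :: encodeNum i
  | .t i => Sym.t :: encodeNum i
  | .cnot c i _ => Sym.cnot :: (encodeNum c ++ encodeNum i)
  | .toffoli c d i _ _ _ => Sym.toffoli :: (encodeNum c ++ encodeNum d ++ encodeNum i)

/-- The description of a circuit: the numbers of its wires, inputs and outputs, and its gates. -/
def Circuit.encode {m n : ℕ} (C : Circuit m n) : List Sym :=
  encodeNum C.wires ++ encodeNum m ++ encodeNum n ++ C.gates.flatMap Gate.encode

theorem encodeNum_append_inj {k l : ℕ} {s t : List Sym}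
    (h : encodeNum k ++ s = encodeNum l ++ t) : k = l ∧ s = t := by
  induction k generalizing l with
  | zero => cases l <;> simp_all [encodeNum, List.replicate_succ]
  | succ k ih =>
    cases l with
    | zero => simp [encodeNum, List.replicate_succ] at h
    | succ l =>
      have := @ih l (by simpa [encodeNum, List.replicate_succ] using h)
      exact ⟨by rw [this.1], this.2⟩

theorem Gate.encode_append_inj {w : ℕ} {g g' : Gate (Fin w)} {s t : List Sym}
    (h : g.encode ++ s = g'.encode ++ t) : g = g' ∧ s = t := by
  cases g <;> cases g' <;>
    simp only [Gate.encode, List.cons_append, List.append_assoc, List.cons.injEq, reduceCtorEq,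
      false_and, true_and] at h
  · obtain ⟨h₁, h₂⟩ := encodeNum_append_inj h
    exact ⟨by simp [Fin.ext h₁], h₂⟩
  · obtain ⟨h₁, h₂⟩ := encodeNum_append_inj h
    exact ⟨by simp [Fin.ext h₁], h₂⟩
  · obtain ⟨h₁, h'⟩ := encodeNum_append_inj h
    obtain ⟨h₂, h₃⟩ := encodeNum_append_inj h'
    exact ⟨by simp [Fin.ext h₁, Fin.ext h₂], h₃⟩
  · obtain ⟨h₁, h'⟩ := encodeNum_append_inj h
    obtain ⟨h₂, h''⟩ := encodeNum_append_inj h'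
    obtain ⟨h₃, h₄⟩ := encodeNum_append_inj h''
    exact ⟨by simp [Fin.ext h₁, Fin.ext h₂, Fin.ext h₃], h₄⟩

theorem Gate.flatMap_encode_injective {w : ℕ} {gs gs' : List (Gate (Fin w))}
    (h : gs.flatMap Gate.encode = gs'.flatMap Gate.encode) : gs = gs' := by
  induction gs generalizing gs' with
  | nil =>
    cases gs' with
    | nil => rfl
    | cons g' _ => cases g' <;> simp [Gate.encode] at h
  | cons g gs ih =>
    cases gs' with
    | nil => cases g <;> simp [Gate.encode] at h
    | cons g' gs' =>
      rw [List.flatMap_cons, List.flatMap_cons] at h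
      obtain ⟨hg, hgs⟩ := Gate.encode_append_inj h
      rw [hg, ih hgs]

/-- A description determines the circuit. -/
theorem Circuit.encode_injective {m n : ℕ} :
    Function.Injective (Circuit.encode : Circuit m n → List Sym) := by
  rintro ⟨w, h₁, h₂, gs⟩ ⟨w', h₁', h₂', gs'⟩ h
  simp only [Circuit.encode, List.append_assoc] at h
  obtain ⟨rfl, h⟩ := encodeNum_append_inj h
  have h := (encodeNum_append_inj (encodeNum_append_inj h).2).2
  rw [Gate.flatMap_encode_injective h]

/-! ### Uniform QPT algorithms -/

/-- A uniform QPT algorithm that, for the security parameter `n`, maps `nIn n` qubits to `nOut n`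
qubits: a family of circuits, one for each `n`, whose description is computed from `1ⁿ` by a
deterministic Turing machine in time polynomial in `n`. -/
structure QPT (nIn nOut : ℕ → ℕ) where
  circuit : ∀ n, Circuit (nIn n) (nOut n)
  uniform : Nonempty (Turing.TM2ComputableInPolyTime
    Computability.unaryEncodeNat (id : List Sym → List Sym) fun n => (circuit n).encode)

/-! ### EFIs -/

/-- The trace distance `½ ‖ρ - σ‖₁`, half the sum of the singular values of `ρ - σ`. -/
def traceDist {κ : Type} [Fintype κ] [DecidableEq κ] (ρ σ : Matrix κ κ ℂ) : ℝ :=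
  (1 / 2) * ∑ i, Real.sqrt ((Matrix.isHermitian_conjTranspose_mul_self (ρ - σ)).eigenvalues i)

/-- The one-qubit state `|b⟩⟨b|`. -/
def basisState (b : Bool) : Matrix (Fin 1 → Bool) (Fin 1 → Bool) ℂ :=
  Matrix.single (fun _ => b) (fun _ => b) 1

/-- The state `ρ_b` output by `StateGen(b, 1ⁿ)`; the bit `b` is the one-qubit input. -/
def QPT.state {ℓ : ℕ → ℕ} (S : QPT (fun _ => 1) ℓ) (b : Bool) (n : ℕ) :
    Matrix (Fin (ℓ n) → Bool) (Fin (ℓ n) → Bool) ℂ :=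
  (S.circuit n).run (basisState b)

/-- `|Pr[1 ← A(1ⁿ, ρ₀)] - Pr[1 ← A(1ⁿ, ρ₁)]|`. -/
def advantage {ℓ : ℕ → ℕ} (S : QPT (fun _ => 1) ℓ) (A : QPT ℓ (fun _ => 1)) (n : ℕ) : ℝ :=
  |(A.circuit n).acceptProb (S.state false n) - (A.circuit n).acceptProb (S.state true n)|

/-- No uniform QPT adversary has more than a negligible advantage. -/
def ComputationallyIndistinguishable {ℓ : ℕ → ℕ} (S : QPT (fun _ => 1) ℓ) : Prop :=
  ∀ A : QPT ℓ (fun _ => 1),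
    SuperpolynomialDecay atTop (fun n : ℕ => (n : ℝ)) (advantage S A)

/-- The trace distance of the two states is at least `1 / poly(n)`. -/
def StatisticallyDistinguishable {ℓ : ℕ → ℕ} (S : QPT (fun _ => 1) ℓ) : Prop :=
  ∃ p : Polynomial ℝ, ∀ᶠ n : ℕ in atTop,
    0 < p.eval (n : ℝ) ∧ 1 / p.eval (n : ℝ) ≤ traceDist (S.state false n) (S.state true n)

/-- `S` is an `ℓ`-qubit EFI. -/
structure IsEFI {ℓ : ℕ → ℕ} (S : QPT (fun _ => 1) ℓ) : Prop where
  indistinguishable : ComputationallyIndistinguishable S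
  distinguishable : StatisticallyDistinguishable S

end QEFI

end

/-! ### Composition of polynomial-time Turing machines -/

namespace StateTransition

variable {α β : Type*}

/-! The adversary runs the swap test. Given an unknown state `ρ`, it prepares a fresh copy of `ρ_b`
with the generator itself and measures the antisymmetric part of the pair; the outcome `1` has
probability `(tr ρ - tr (ρ_b ρ)) / 2` (`Circuit.acceptProb_swapTest`). Both generated states have
trace one, so its advantage is `|tr (ρ_b (ρ₀ - ρ₁))| / 2`. Subtracting the traces for `b = 0` and `b
= 1` gives `tr (ρ₀ - ρ₁)² ≤ 2 (adv₀ + adv₁)` (`trace_conjTranspose_mul_state_sub_le`): negligible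
advantages force a negligible Hilbert–Schmidt distance.

In dimension `d`, Cauchy–Schwarz on the singular values bounds the squared trace distance by `d / 4`
times the squared Hilbert–Schmidt distance (`traceDist_sq_le`). For `O(log n)` qubits `d = 2 ^ ℓ n`
is at most a power of `n`, so the trace distance would be negligible too, against the bound `1 / p`.

Most of the work is to show that this adversary is uniform. Its circuit is an explicit rewriting of
the generator's description. The rewriting is done by a while program on stacks, which a Turing
machine implements with one step per elementary instruction (`swapTestString_computable`).
Polynomial-time machines compose (`TM2ComputableInPolyTime.comp`), and so the description of the
swap test is computed from `1ⁿ`. Its gates are built from `H`, `T`, CNOT and Toffoli and evaluated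
on amplitudes (`Circuit.iso_swapTest`). -/

theorem iterate_flip_bind_none (f : α → Option α) (n : ℕ) :
    (flip Bind.bind f)^[n] (none : Option α) = none :=
  Function.iterate_fixed rfl n

/-- `f` takes `a` to `b` in exactly `n` steps. -/
def StepsTo (f : α → Option α) (n : ℕ) (a b : α) : Prop :=
  (flip Bind.bind f)^[n] (some a) = some b

namespace StepsTo

variable {f : α → Option α} {g : β → Option β} {m n : ℕ} {a b c : α}

theorem refl (f : α → Option α) (a : α) : StepsTo f 0 a a := rfl

theorem trans (h₁ : StepsTo f m a b) (h₂ : StepsTo f n b c) : StepsTo f (m + n) a c := by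
  unfold StepsTo at *
  rw [add_comm, Function.iterate_add_apply, h₁, h₂]

theorem single (h : f a = some b) : StepsTo f 1 a b := h

theorem head (h : f a = some b) (h' : StepsTo f n b c) : StepsTo f (n + 1) a c := by
  rw [add_comm]
  exact (single h).trans h'

theorem exists_head (h : StepsTo f (n + 1) a c) : ∃ b, f a = some b ∧ StepsTo f n b c := by
  unfold StepsTo at h
  rw [Function.iterate_succ_apply] at h
  change (flip Bind.bind f)^[n] (f a) = some c at h
  cases hb : f a with
  | none => rw [hb, iterate_flip_bind_none] at h; cases h
  | some b => exact ⟨b, rfl, by rwa [hb] at h⟩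

/-- This is how each of the two machines is simulated inside their composition: one step for one
step, with no change in the running time. -/
theorem map (φ : α → β) (hφ : ∀ a b, f a = some b → g (φ a) = some (φ b))
    (h : StepsTo f n a b) : StepsTo g n (φ a) (φ b) := by
  induction n generalizing a with
  | zero =>
    obtain rfl : a = b := Option.some.inj h
    exact refl g _
  | succ n ih =>
    obtain ⟨c, hc, h⟩ := h.exists_head
    exact head (hφ _ _ hc) (ih h)

end StepsTo

end StateTransition

namespace Turing

open StateTransition

/-! ### Growth of the stacks during a computation -/

namespace TM2

variable {K : Type*} {Γ : K → Type*} {Λ σ : Type*}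

/-- A bound on the number of symbols that a statement pushes. -/
def Stmt.pushes : Stmt Γ Λ σ → ℕ
  | .push _ _ q => q.pushes + 1
  | .peek _ _ q => q.pushes
  | .pop _ _ q => q.pushes
  | .load _ q => q.pushes
  | .branch _ q₁ q₂ => q₁.pushes + q₂.pushes
  | .goto _ => 0
  | .halt => 0

variable [DecidableEq K]

theorem length_stk_stepAux_le (q : Stmt Γ Λ σ) (v : σ) (S : ∀ k, List (Γ k)) (k : K) :
    ((stepAux q v S).stk k).length ≤ (S k).length + q.pushes := by
  induction q generalizing v S with
  | push k' f q ih =>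
    refine (ih v _).trans ?_
    by_cases h : k = k'
    · subst h
      simp only [Function.update_self, List.length_cons, Stmt.pushes]
      omega
    · simp only [Function.update_of_ne h, Stmt.pushes]
      omega
  | pop k' f q ih =>
    refine (ih _ _).trans ?_
    by_cases h : k = k'
    · subst h
      simp only [Function.update_self, List.length_tail, Stmt.pushes]
      omega
    · simp only [Function.update_of_ne h, Stmt.pushes]
      omega
  | peek k' f q ih => exact ih _ _
  | load a q ih => exact ih _ _
  | branch p q₁ q₂ ih₁ ih₂ =>
    have h₁ := ih₁ v S
    have h₂ := ih₂ v S
    simp only [stepAux, Stmt.pushes]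
    cases p v <;> simp only [cond_true, cond_false] <;> omega
  | goto f => simp [stepAux, Stmt.pushes]
  | halt => simp [stepAux, Stmt.pushes]

/-- A machine that stops early cannot write much. Applied to the output stack, this makes the
intermediate word of a composition polynomially long. -/
theorem length_stk_le_of_stepsTo {M : Λ → Stmt Γ Λ σ} {c : ℕ} (hc : ∀ l, (M l).pushes ≤ c)
    {n : ℕ} {a b : Cfg Γ Λ σ} (h : StepsTo (step M) n a b) (k : K) :
    (b.stk k).length ≤ (a.stk k).length + n * c := by
  induction n generalizing a with
  | zero =>
    obtain rfl : a = b := Option.some.inj h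
    simp
  | succ n ih =>
    obtain ⟨a', ha, h⟩ := h.exists_head
    have h₁ := ih h
    obtain ⟨_ | l, v, S⟩ := a
    · simp at ha
    · simp only [step, Option.some.injEq] at ha
      subst ha
      have h₂ := length_stk_stepAux_le (M l) v S k
      have h₃ := hc l
      rw [Nat.succ_mul]
      dsimp only
      omega

end TM2

theorem initList_stk (tm : FinTM2) (s : List (tm.Γ tm.k₀)) :
    (initList tm s).stk = Function.update (fun _ => []) tm.k₀ s := by
  funext k
  by_cases h : k = tm.k₀
  · subst h; simp [initList]
  · simp [initList, h]

theorem haltList_stk (tm : FinTM2) (s : List (tm.Γ tm.k₁)) :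
    (haltList tm s).stk = Function.update (fun _ => []) tm.k₁ s := by
  funext k
  by_cases h : k = tm.k₁
  · subst h; simp [haltList]
  · simp [haltList, h]

/-! ### The composed machine and its simulation -/

namespace FinTM2

variable (M₁ M₂ : FinTM2) (A : Type)

/-- The alphabets of the composition of two machines, which has one stack more than both of
them have together. -/
abbrev CompΓ : (M₁.K ⊕ M₂.K) ⊕ Unit → Type :=
  Sum.elim (Sum.elim M₁.Γ M₂.Γ) fun _ => A

/-- The labels of the composition: those of the two machines, and two for the transfer of the
output of the first machine to the input of the second one. -/
abbrev CompΛ : Type := (M₁.Λ ⊕ M₂.Λ) ⊕ Bool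

/-- The internal states of the composition. -/
abbrev CompSigma : Type := M₁.σ × M₂.σ × Option A

variable {M₁ M₂ A}

/-- The stacks of the composition. -/
def joinStk (S₁ : ∀ k, List (M₁.Γ k)) (S₂ : ∀ k, List (M₂.Γ k)) (t : List A) :
    ∀ k, List (CompΓ M₁ M₂ A k)
  | .inl (.inl k) => S₁ k
  | .inl (.inr k) => S₂ k
  | .inr _ => t

section

variable (S₁ : ∀ k, List (M₁.Γ k)) (S₂ : ∀ k, List (M₂.Γ k)) (t : List A)

theorem update_joinStk_left (k : M₁.K) (l : List (M₁.Γ k)) :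
    Function.update (joinStk S₁ S₂ t) (.inl (.inl k)) l =
      joinStk (Function.update S₁ k l) S₂ t := by
  funext k'
  obtain (k' | k') | k' := k'
  · by_cases h : k' = k
    · subst h
      exact (Function.update_self ..).trans (Function.update_self k' l S₁).symm
    · change _ = Function.update S₁ k l k'
      rw [Function.update_of_ne h]
      exact Function.update_of_ne (by simpa using h) ..
  · exact Function.update_of_ne (by simp) ..
  · exact Function.update_of_ne (by simp) ..

theorem update_joinStk_right (k : M₂.K) (l : List (M₂.Γ k)) :
    Function.update (joinStk S₁ S₂ t) (.inl (.inr k)) l =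
      joinStk S₁ (Function.update S₂ k l) t := by
  funext k'
  obtain (k' | k') | k' := k'
  · exact Function.update_of_ne (by simp) ..
  · by_cases h : k' = k
    · subst h
      exact (Function.update_self ..).trans (Function.update_self k' l S₂).symm
    · change _ = Function.update S₂ k l k'
      rw [Function.update_of_ne h]
      exact Function.update_of_ne (by simpa using h) ..
  · exact Function.update_of_ne (by simp) ..

theorem update_joinStk_unit (l : List A) :
    Function.update (joinStk S₁ S₂ t) (.inr ()) l = joinStk S₁ S₂ l := by
  funext k'
  obtain (k' | k') | k' := k'
  · exact Function.update_of_ne (by simp) ..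
  · exact Function.update_of_ne (by simp) ..
  · exact Function.update_self ..

end

/-- A statement of the first machine, as one of the composition. -/
def liftLeft : TM2.Stmt M₁.Γ M₁.Λ M₁.σ →
    TM2.Stmt (CompΓ M₁ M₂ A) (CompΛ M₁ M₂) (CompSigma M₁ M₂ A)
  | .push k f q => .push (.inl (.inl k)) (fun v => f v.1) (liftLeft q)
  | .peek k f q => .peek (.inl (.inl k)) (fun v o => (f v.1 o, v.2)) (liftLeft q)
  | .pop k f q => .pop (.inl (.inl k)) (fun v o => (f v.1 o, v.2)) (liftLeft q)
  | .load a q => .load (fun v => (a v.1, v.2)) (liftLeft q)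
  | .branch p q₁ q₂ => .branch (fun v => p v.1) (liftLeft q₁) (liftLeft q₂)
  | .goto f => .goto fun v => .inl (.inl (f v.1))
  | .halt => .goto fun _ => .inr false

/-- A statement of the second machine, as one of the composition. -/
def liftRight : TM2.Stmt M₂.Γ M₂.Λ M₂.σ →
    TM2.Stmt (CompΓ M₁ M₂ A) (CompΛ M₁ M₂) (CompSigma M₁ M₂ A)
  | .push k f q => .push (.inl (.inr k)) (fun v => f v.2.1) (liftRight q)
  | .peek k f q => .peek (.inl (.inr k)) (fun v o => (v.1, f v.2.1 o, v.2.2)) (liftRight q)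
  | .pop k f q => .pop (.inl (.inr k)) (fun v o => (v.1, f v.2.1 o, v.2.2)) (liftRight q)
  | .load a q => .load (fun v => (v.1, a v.2.1, v.2.2)) (liftRight q)
  | .branch p q₁ q₂ => .branch (fun v => p v.2.1) (liftRight q₁) (liftRight q₂)
  | .goto f => .goto fun v => .inl (.inr (f v.2.1))
  | .halt => .halt

/-- A configuration of the first machine, as one of the composition. -/
def leftCfg (w : M₂.σ × Option A) (S₂ : ∀ k, List (M₂.Γ k)) (t : List A) (c : M₁.Cfg) :
    TM2.Cfg (CompΓ M₁ M₂ A) (CompΛ M₁ M₂) (CompSigma M₁ M₂ A) where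
  l := some (c.l.elim (.inr false) fun l => .inl (.inl l))
  var := (c.var, w)
  stk := joinStk c.stk S₂ t

/-- A configuration of the second machine, as one of the composition. -/
def rightCfg (v : M₁.σ) (o : Option A) (S₁ : ∀ k, List (M₁.Γ k)) (t : List A) (c : M₂.Cfg) :
    TM2.Cfg (CompΓ M₁ M₂ A) (CompΛ M₁ M₂) (CompSigma M₁ M₂ A) where
  l := c.l.map fun l => .inl (.inr l)
  var := (v, c.var, o)
  stk := joinStk S₁ c.stk t

/-- A lifted statement touches only the stacks and the state component of the first machine. A halt
becomes a jump to the transfer loop, which is the label that `leftCfg` gives to a halted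
configuration. -/
theorem stepAux_liftLeft (w : M₂.σ × Option A) (S₂ : ∀ k, List (M₂.Γ k)) (t : List A)
    (q : TM2.Stmt M₁.Γ M₁.Λ M₁.σ) (v : M₁.σ) (S : ∀ k, List (M₁.Γ k)) :
    TM2.stepAux (liftLeft q) (v, w) (joinStk S S₂ t) =
      leftCfg w S₂ t (TM2.stepAux q v S) := by
  induction q generalizing v S with
  | push k f q ih =>
    exact (congrArg (TM2.stepAux (liftLeft q) (v, w)) (update_joinStk_left ..)).trans (ih _ _)
  | peek k f q ih => exact ih _ _
  | pop k f q ih =>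
    exact (congrArg (TM2.stepAux (liftLeft q) _) (update_joinStk_left ..)).trans (ih _ _)
  | load a q ih => simp only [liftLeft, TM2.stepAux, ih]
  | branch p q₁ q₂ ih₁ ih₂ =>
    simp only [liftLeft, TM2.stepAux, ih₁, ih₂]
    cases p v <;> rfl
  | goto f => rfl
  | halt => rfl

theorem stepAux_liftRight (v₁ : M₁.σ) (o : Option A) (S₁ : ∀ k, List (M₁.Γ k)) (t : List A)
    (q : TM2.Stmt M₂.Γ M₂.Λ M₂.σ) (v : M₂.σ) (S : ∀ k, List (M₂.Γ k)) :
    TM2.stepAux (liftRight q) (v₁, v, o) (joinStk S₁ S t) =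
      rightCfg v₁ o S₁ t (TM2.stepAux q v S) := by
  induction q generalizing v S with
  | push k f q ih =>
    exact (congrArg (TM2.stepAux (liftRight q) (v₁, v, o)) (update_joinStk_right ..)).trans (ih _ _)
  | peek k f q ih => exact ih _ _
  | pop k f q ih =>
    exact (congrArg (TM2.stepAux (liftRight q) _) (update_joinStk_right ..)).trans (ih _ _)
  | load a q ih => simp only [liftRight, TM2.stepAux, ih]
  | branch p q₁ q₂ ih₁ ih₂ =>
    simp only [liftRight, TM2.stepAux, ih₁, ih₂]
    cases p v <;> rfl
  | goto f => rfl
  | halt => rfl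

variable [Fintype A] [Inhabited A] (e₁ : M₁.Γ M₁.k₁ ≃ A) (e₂ : M₂.Γ M₂.k₀ ≃ A)

attribute [local instance] FinTM2.kFin FinTM2.ΛFin FinTM2.σFin FinTM2.Γk₀Fin

/-- The composition of two machines: it runs the first one, moves its output to the input stack
of the second one by way of an additional stack, and runs the second one. -/
def comp : FinTM2 where
  K := (M₁.K ⊕ M₂.K) ⊕ Unit
  k₀ := .inl (.inl M₁.k₀)
  k₁ := .inl (.inr M₂.k₁)
  Γ := CompΓ M₁ M₂ A
  Λ := CompΛ M₁ M₂
  main := .inl (.inl M₁.main)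
  σ := CompSigma M₁ M₂ A
  initialState := (M₁.initialState, M₂.initialState, none)
  Γk₀Fin := M₁.Γk₀Fin
  m
    | .inl (.inl l) => liftLeft (M₁.m l)
    | .inl (.inr l) => liftRight (M₂.m l)
    | .inr false =>
      .pop (.inl (.inl M₁.k₁)) (fun v o => (v.1, v.2.1, o.map e₁))
        (.branch (fun v => v.2.2.isSome)
          (.push (.inr ()) (fun v => v.2.2.getD default) (.goto fun _ => .inr false))
          (.goto fun _ => .inr true))
    | .inr true =>
      .pop (.inr ()) (fun v o => (v.1, v.2.1, o))
        (.branch (fun v => v.2.2.isSome)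
          (.push (.inl (.inr M₂.k₀)) (fun v => e₂.symm (v.2.2.getD default))
            (.goto fun _ => .inr true))
          (.goto fun _ => .inl (.inr M₂.main)))

theorem stepsTo_comp_left {n : ℕ} {a b : M₁.Cfg} (h : StepsTo M₁.step n a b)
    (w : M₂.σ × Option A) (S₂ : ∀ k, List (M₂.Γ k)) (t : List A) :
    StepsTo (comp e₁ e₂).step n (leftCfg w S₂ t a) (leftCfg w S₂ t b) := by
  refine h.map _ ?_
  rintro ⟨_ | l, v, S⟩ b h
  · simp at h
  · obtain rfl : TM2.stepAux (M₁.m l) v S = b := Option.some.inj h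
    exact congrArg some (stepAux_liftLeft w S₂ t (M₁.m l) v S)

theorem stepsTo_comp_right {n : ℕ} {a b : M₂.Cfg} (h : StepsTo M₂.step n a b)
    (v₁ : M₁.σ) (o : Option A) (S₁ : ∀ k, List (M₁.Γ k)) (t : List A) :
    StepsTo (comp e₁ e₂).step n (rightCfg v₁ o S₁ t a) (rightCfg v₁ o S₁ t b) := by
  refine h.map _ ?_
  rintro ⟨_ | l, v, S⟩ b h
  · simp at h
  · obtain rfl : TM2.stepAux (M₂.m l) v S = b := Option.some.inj h
    exact congrArg some (stepAux_liftRight v₁ o S₁ t (M₂.m l) v S)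

theorem step_comp_unload_nil (v : CompSigma M₁ M₂ A) {S₁ : ∀ k, List (M₁.Γ k)}
    (h : S₁ M₁.k₁ = []) (S₂ : ∀ k, List (M₂.Γ k)) (t : List A) :
    (comp e₁ e₂).step ⟨some (.inr false), v, joinStk S₁ S₂ t⟩ =
      some ⟨some (.inr true), (v.1, v.2.1, none), joinStk S₁ S₂ t⟩ := by
  have h' : joinStk S₁ S₂ t (.inl (.inl M₁.k₁)) = [] := h
  have hu : Function.update (joinStk S₁ S₂ t) (.inl (.inl M₁.k₁)) [] = joinStk S₁ S₂ t :=
    Function.update_eq_self_iff.mpr h'.symm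
  simp only [step, comp, TM2.step, TM2.stepAux]
  rw [h']
  exact congrArg (fun S => some (TM2.Cfg.mk (Λ := CompΛ M₁ M₂) (some (.inr true))
    ((v.1, v.2.1, none) : CompSigma M₁ M₂ A) S)) hu

theorem step_comp_unload_cons (v : CompSigma M₁ M₂ A) {S₁ : ∀ k, List (M₁.Γ k)}
    {a : M₁.Γ M₁.k₁} {l : List (M₁.Γ M₁.k₁)} (h : S₁ M₁.k₁ = a :: l)
    (S₂ : ∀ k, List (M₂.Γ k)) (t : List A) :
    (comp e₁ e₂).step ⟨some (.inr false), v, joinStk S₁ S₂ t⟩ =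
      some ⟨some (.inr false), (v.1, v.2.1, some (e₁ a)),
        joinStk (Function.update S₁ M₁.k₁ l) S₂ (e₁ a :: t)⟩ := by
  have h' : joinStk S₁ S₂ t (.inl (.inl M₁.k₁)) = a :: l := h
  have hu := update_joinStk_left S₁ S₂ t M₁.k₁ l
  have hu' := update_joinStk_unit (Function.update S₁ M₁.k₁ l) S₂ t (e₁ a :: t)
  rw [← hu] at hu'
  simp only [step, comp, TM2.step, TM2.stepAux]
  rw [h']
  refine congrArg (fun S => some (TM2.Cfg.mk (Λ := CompΛ M₁ M₂) (some (.inr false))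
    ((v.1, v.2.1, some (e₁ a)) : CompSigma M₁ M₂ A) S)) (Eq.trans ?_ hu')
  exact congrArg (Function.update _ _) (congrArg (e₁ a :: ·) (congrFun hu (.inr ())))

theorem step_comp_load_nil (v : CompSigma M₁ M₂ A) (S₁ : ∀ k, List (M₁.Γ k))
    (S₂ : ∀ k, List (M₂.Γ k)) :
    (comp e₁ e₂).step ⟨some (.inr true), v, joinStk S₁ S₂ []⟩ =
      some ⟨some (.inl (.inr M₂.main)), (v.1, v.2.1, none), joinStk S₁ S₂ []⟩ :=
  congrArg (fun S => some (TM2.Cfg.mk (Λ := CompΛ M₁ M₂) (some (.inl (.inr M₂.main)))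
    ((v.1, v.2.1, none) : CompSigma M₁ M₂ A) S)) (update_joinStk_unit S₁ S₂ [] [])

theorem step_comp_load_cons (v : CompSigma M₁ M₂ A) (S₁ : ∀ k, List (M₁.Γ k))
    (S₂ : ∀ k, List (M₂.Γ k)) (a : A) (t : List A) :
    (comp e₁ e₂).step ⟨some (.inr true), v, joinStk S₁ S₂ (a :: t)⟩ =
      some ⟨some (.inr true), (v.1, v.2.1, some a),
        joinStk S₁ (Function.update S₂ M₂.k₀ (e₂.symm a :: S₂ M₂.k₀)) t⟩ := by
  have hu := update_joinStk_unit S₁ S₂ (a :: t) t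
  have hu' := update_joinStk_right S₁ S₂ t M₂.k₀ (e₂.symm a :: S₂ M₂.k₀)
  refine congrArg (fun S => some (TM2.Cfg.mk (Λ := CompΛ M₁ M₂) (some (.inr true))
    ((v.1, v.2.1, some a) : CompSigma M₁ M₂ A) S)) (Eq.trans ?_ hu')
  exact congrArg (fun S : ∀ k, List (CompΓ M₁ M₂ A k) => Function.update S (.inl (.inr M₂.k₀))
    (e₂.symm a :: S (.inl (.inr M₂.k₀)))) hu

/-- Moving a word from one stack to another reverses it. The additional stack makes the transfer two
moves, and the second one restores the order. Each loop spends one more step on finding its source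
empty. -/
theorem stepsTo_comp_unload (v₁ : M₁.σ) (v₂ : M₂.σ) (o : Option A)
    (S₂ : ∀ k, List (M₂.Γ k)) (s t : List A) :
    StepsTo (comp e₁ e₂).step (s.length + 1)
      ⟨some (.inr false), (v₁, v₂, o),
        joinStk (Function.update (fun _ => []) M₁.k₁ (s.map e₁.symm)) S₂ t⟩
      ⟨some (.inr true), (v₁, v₂, none), joinStk (fun _ => []) S₂ (s.reverse ++ t)⟩ := by
  induction s generalizing o t with
  | nil =>
    refine StepsTo.single ?_
    rw [List.map_nil, Function.update_eq_self_iff.mpr rfl]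
    exact step_comp_unload_nil e₁ e₂ (v₁, v₂, o) rfl S₂ t
  | cons a s ih =>
    rw [List.length_cons, List.reverse_cons, List.append_assoc, List.singleton_append]
    refine StepsTo.head ?_ (ih (some a) (a :: t))
    refine (step_comp_unload_cons e₁ e₂ (v₁, v₂, o) (Function.update_self ..) S₂ t).trans ?_
    rw [Function.update_idem, e₁.apply_symm_apply]

theorem stepsTo_comp_load (v₁ : M₁.σ) (v₂ : M₂.σ) (o : Option A)
    (S₁ : ∀ k, List (M₁.Γ k)) (s t : List A) :
    StepsTo (comp e₁ e₂).step (s.length + 1)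
      ⟨some (.inr true), (v₁, v₂, o),
        joinStk S₁ (Function.update (fun _ => []) M₂.k₀ (t.map e₂.symm)) s⟩
      ⟨some (.inl (.inr M₂.main)), (v₁, v₂, none),
        joinStk S₁ (Function.update (fun _ => []) M₂.k₀ ((s.reverse ++ t).map e₂.symm)) []⟩ := by
  induction s generalizing o t with
  | nil => exact StepsTo.single (step_comp_load_nil e₁ e₂ (v₁, v₂, o) S₁ _)
  | cons a s ih =>
    rw [List.length_cons, List.reverse_cons, List.append_assoc, List.singleton_append]
    refine StepsTo.head ?_ (ih (some a) (a :: t))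
    refine (step_comp_load_cons e₁ e₂ (v₁, v₂, o) S₁ _ a s).trans ?_
    rw [Function.update_idem, Function.update_self, List.map_cons]

/-- `haltList` requires the initial internal state and leaves only the output stack nonempty. So
after the transfer the second machine is exactly in its initial configuration, and the final
configuration is a legitimate halting one for the composition. -/
theorem stepsTo_comp {l : List (M₁.Γ M₁.k₀)} {s : List A} {r : List (M₂.Γ M₂.k₁)} {n₁ n₂ : ℕ}
    (h₁ : StepsTo M₁.step n₁ (initList M₁ l) (haltList M₁ (s.map e₁.symm)))
    (h₂ : StepsTo M₂.step n₂ (initList M₂ (s.map e₂.symm)) (haltList M₂ r)) :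
    StepsTo (comp e₁ e₂).step (n₁ + (s.length + 1) + (s.length + 1) + n₂)
      (initList (comp e₁ e₂) l) (haltList (comp e₁ e₂) r) := by
  have hi : initList (comp e₁ e₂) l =
      leftCfg (M₂.initialState, none) (fun _ => []) [] (initList M₁ l) := by
    have := (initList_stk (comp e₁ e₂) l)
    refine TM2.Cfg.mk.injEq .. |>.mpr ⟨rfl, rfl, this.trans ?_⟩
    rw [initList_stk, ← update_joinStk_left]
    congr 1
    funext k
    obtain (k | k) | k := k <;> rfl
  have hh : haltList (comp e₁ e₂) r =
      rightCfg M₁.initialState none (fun _ => []) [] (haltList M₂ r) := by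
    have := (haltList_stk (comp e₁ e₂) r)
    refine TM2.Cfg.mk.injEq .. |>.mpr ⟨rfl, rfl, this.trans ?_⟩
    rw [haltList_stk, ← update_joinStk_right]
    congr 1
    funext k
    obtain (k | k) | k := k <;> rfl
  rw [hi, hh]
  have h₁' := stepsTo_comp_left e₁ e₂ h₁ (M₂.initialState, none) (fun _ => []) []
  have h₂' := stepsTo_comp_right e₁ e₂ h₂ M₁.initialState none (fun _ => []) []
  have h₃ := stepsTo_comp_unload e₁ e₂ M₁.initialState M₂.initialState none (fun _ => []) s []
  have h₄ := stepsTo_comp_load e₁ e₂ M₁.initialState M₂.initialState none (fun _ => [])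
    (s.reverse ++ []) []
  rw [List.append_nil, List.reverse_reverse, List.append_nil, List.length_reverse,
    List.map_nil, Function.update_eq_self_iff.mpr rfl] at h₄
  rw [List.append_nil] at h₃
  rw [← haltList_stk] at h₃
  rw [← initList_stk] at h₄
  exact ((h₁'.trans h₃).trans h₄).trans h₂'

end FinTM2

theorem TM2ComputableInPolyTime.comp {α β γ αΓ βΓ γΓ : Type} [Inhabited βΓ]
    {eα : α → List αΓ} {eβ : β → List βΓ} {eγ : γ → List γΓ} {f : α → β} {g : β → γ}
    (h₁ : TM2ComputableInPolyTime eα eβ f) (h₂ : TM2ComputableInPolyTime eβ eγ g) :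
    Nonempty (TM2ComputableInPolyTime eα eγ (g ∘ f)) := by
  let _ : Fintype βΓ := @Fintype.ofEquiv _ _ h₂.tm.Γk₀Fin h₂.inputAlphabet
  let _ := h₁.tm.ΛFin
  obtain ⟨c, hc⟩ : ∃ c, ∀ l, (h₁.tm.m l).pushes ≤ c :=
    ⟨∑ l, (h₁.tm.m l).pushes, fun l =>
      Finset.single_le_sum (f := fun l => (h₁.tm.m l).pushes) (fun _ _ => Nat.zero_le _)
        (Finset.mem_univ l)⟩
  -- Bounds the length of the intermediate word: at most `c` symbols per step, plus the input, which
  -- counts when the first machine uses one stack for input and output.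
  let len : Polynomial ℕ := .X + h₁.time * .C c
  refine ⟨⟨⟨FinTM2.comp h₁.outputAlphabet h₂.inputAlphabet, h₁.inputAlphabet,
    h₂.outputAlphabet⟩, h₁.time + 2 * (len + 1) + h₂.time.comp len, fun a => ?_⟩⟩
  obtain ⟨⟨n₁, hn₁⟩, hle₁⟩ := h₁.outputsFun a
  obtain ⟨⟨n₂, hn₂⟩, hle₂⟩ := h₂.outputsFun (f a)
  change StepsTo h₁.tm.step n₁ _ (haltList h₁.tm _) at hn₁
  change StepsTo h₂.tm.step n₂ _ (haltList h₂.tm _) at hn₂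
  have hlen : (eβ (f a)).length ≤ len.eval (eα a).length := by
    have := TM2.length_stk_le_of_stepsTo hc hn₁ h₁.tm.k₁
    rw [haltList_stk, Function.update_self, List.length_map] at this
    refine this.trans ?_
    have h₀ : ((initList h₁.tm ((eα a).map h₁.inputAlphabet.invFun)).stk h₁.tm.k₁).length ≤
        (eα a).length := by
      rw [initList_stk]
      by_cases h : h₁.tm.k₁ = h₁.tm.k₀
      · have : ∀ (k) (h : k = h₁.tm.k₀) (l : List (h₁.tm.Γ h₁.tm.k₀)),
            (Function.update (fun _ => []) h₁.tm.k₀ l k).length = l.length := by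
          rintro _ rfl l
          simp
        rw [this _ h, List.length_map]
      · simp [Function.update_of_ne h]
    simp only [len, Polynomial.eval_add, Polynomial.eval_X, Polynomial.eval_mul,
      Polynomial.eval_C]
    exact Nat.add_le_add h₀ (Nat.mul_le_mul_right c hle₁)
  refine ⟨⟨_, FinTM2.stepsTo_comp h₁.outputAlphabet h₂.inputAlphabet hn₁ hn₂⟩, ?_⟩
  -- A polynomial with natural coefficients is monotone.
  have hmono : h₂.time.eval (eβ (f a)).length ≤ h₂.time.eval (len.eval (eα a).length) := by
    rw [Polynomial.eval_eq_sum_range, Polynomial.eval_eq_sum_range]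
    gcongr
  simp only [Polynomial.eval_add, Polynomial.eval_mul, Polynomial.eval_comp,
    Polynomial.eval_ofNat, Polynomial.eval_one]
  simp only at hle₁ hle₂
  omega

end Turing

open Turing StateTransition

/-! ### While programs on stacks -/

/-- While programs on stacks with alphabet `A`, indexed by `K`. -/
inductive StackProg (K A : Type) : Type
  | skip : StackProg K A
  | push (k : K) (a : A) : StackProg K A
  | pop (k : K) : StackProg K A
  | move (k k' : K) : StackProg K A
  | seq (p q : StackProg K A) : StackProg K A
  | loop (k : K) (c : A → Bool) (p : StackProg K A) : StackProg K A

namespace StackProg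

variable {K A : Type}

/-- The labels used in the implementation of a program by a Turing machine. -/
def Label : StackProg K A → Type
  | seq p q => p.Label ⊕ q.Label
  | loop _ _ p => Option p.Label
  | _ => Unit

/-- There are finitely many labels. -/
instance fintypeLabel : ∀ p : StackProg K A, Fintype p.Label
  | skip => inferInstanceAs (Fintype Unit)
  | push _ _ => inferInstanceAs (Fintype Unit)
  | pop _ => inferInstanceAs (Fintype Unit)
  | move _ _ => inferInstanceAs (Fintype Unit)
  | seq p q =>
    let _ := fintypeLabel p
    let _ := fintypeLabel q
    inferInstanceAs (Fintype (p.Label ⊕ q.Label))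
  | loop _ _ p =>
    let _ := fintypeLabel p
    inferInstanceAs (Fintype (Option p.Label))

/-- The label where a program starts. -/
def entry : ∀ p : StackProg K A, p.Label
  | skip => ()
  | push _ _ => ()
  | pop _ => ()
  | move _ _ => ()
  | seq p _ => Sum.inl p.entry
  | loop _ _ p => (none : Option p.Label)

/-- The implementation of a program in a machine whose labels include those of the program; it
ends with a jump to `exit`. -/
def code [Inhabited A] {Λ : Type} : ∀ p : StackProg K A, (p.Label → Λ) → Λ → p.Label →
    TM2.Stmt (fun _ : K => A) Λ (Option A)
  | skip, _, exit, _ => .goto fun _ => exit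
  | push k a, _, exit, _ => .push k (fun _ => a) (.goto fun _ => exit)
  | pop k, _, exit, _ => .pop k (fun v _ => v) (.goto fun _ => exit)
  | move k k', _, exit, _ =>
    .pop k (fun _ o => o) (.push k' (fun v => v.getD default) (.goto fun _ => exit))
  | seq p q, emb, _, .inl l => p.code (fun l => emb (.inl l)) (emb (.inr q.entry)) l
  | seq _ q, emb, exit, .inr l => q.code (fun l => emb (.inr l)) exit l
  | loop k c p, emb, exit, none =>
    .peek k (fun _ o => o)
      (.branch (fun v => v.any c) (.goto fun _ => emb (some p.entry)) (.goto fun _ => exit))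
  | loop _ _ p, emb, _, some l => p.code (fun l => emb (some l)) (emb none) l

variable [DecidableEq K]

/-- `Runs p S S' t`: started with stacks `S`, the program `p` ends with stacks `S'` after at
most `t` steps. -/
inductive Runs : StackProg K A → (K → List A) → (K → List A) → ℕ → Prop
  | skip (S) : Runs .skip S S 1
  | push (k a S) : Runs (.push k a) S (Function.update S k (a :: S k)) 1
  | pop (k S) : Runs (.pop k) S (Function.update S k (S k).tail) 1
  | move {k k' S a l} (h : S k = a :: l) :
    Runs (.move k k') S
      (Function.update (Function.update S k l) k' (a :: Function.update S k l k')) 1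
  | seq {p q S S' S'' t t'} (hp : Runs p S S' t) (hq : Runs q S' S'' t') :
    Runs (.seq p q) S S'' (t + t')
  | loop_done {k c S} (p) (h : (S k).head?.any c = false) : Runs (.loop k c p) S S 1
  | loop_step {k c p S S' S'' t t'} (h : (S k).head?.any c = true) (hp : Runs p S S' t)
    (hl : Runs (.loop k c p) S' S'' t') : Runs (.loop k c p) S S'' (t + t' + 1)
  | mono {p S S' t t'} (h : Runs p S S' t) (ht : t ≤ t') : Runs p S S' t'

theorem _root_.Turing.TM2.step_of_eq {Γ : K → Type} {Λ σ : Type} {M : Λ → TM2.Stmt Γ Λ σ} {l : Λ}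
    {q : TM2.Stmt Γ Λ σ} (h : M l = q) (v : σ) (S : ∀ k, List (Γ k)) :
    TM2.step M ⟨some l, v, S⟩ = some (TM2.stepAux q v S) := by
  rw [← h, TM2.step]

/-- Induction on the run: every elementary instruction and every loop test is one machine step, and
the exit of one piece of code is the entry of the next. The internal state only buffers the last
symbol read, so it may be arbitrary at the start and is unspecified at the end. -/
theorem Runs.stepsTo [Inhabited A] {Λ : Type} {M : Λ → TM2.Stmt (fun _ : K => A) Λ (Option A)}
    {p : StackProg K A} {S S' : K → List A} {t : ℕ} (h : Runs p S S' t) {emb : p.Label → Λ}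
    {exit : Λ} (hM : ∀ l, M (emb l) = p.code emb exit l) (v : Option A) :
    ∃ v' : Option A, ∃ t' ≤ t, StepsTo (TM2.step M) t' ⟨some (emb p.entry), v, S⟩
      ⟨some exit, v', S'⟩ := by
  induction h generalizing v exit with
  | skip S => exact ⟨v, 1, le_rfl, StepsTo.single (TM2.step_of_eq (hM ()) v S)⟩
  | push k a S => exact ⟨v, 1, le_rfl, StepsTo.single (TM2.step_of_eq (hM ()) v S)⟩
  | pop k S => exact ⟨v, 1, le_rfl, StepsTo.single (TM2.step_of_eq (hM ()) v S)⟩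
  | @move k k' S a l h =>
    exact ⟨some a, 1, le_rfl, StepsTo.single
      ((TM2.step_of_eq (hM ()) v S).trans (by simp [code, h]))⟩
  | @seq p q S S' S'' t t' _ _ ihp ihq =>
    obtain ⟨v₁, t₁, h₁, hs₁⟩ := @ihp (fun l => emb (.inl l)) (emb (.inr q.entry))
      (fun l => hM (.inl l)) v
    obtain ⟨v₂, t₂, h₂, hs₂⟩ := @ihq (fun l => emb (.inr l)) exit (fun l => hM (.inr l)) v₁
    exact ⟨v₂, t₁ + t₂, add_le_add h₁ h₂, hs₁.trans hs₂⟩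
  | @loop_done k c S p h =>
    refine ⟨(S k).head?, 1, le_rfl, StepsTo.single ?_⟩
    exact (TM2.step_of_eq (hM none) v S).trans (by simp [code, h])
  | @loop_step k c p S S' S'' t t' h _ _ ihp ihl =>
    obtain ⟨v₁, t₁, h₁, hs₁⟩ := @ihp (fun l => emb (some l)) (emb none)
      (fun l => hM (some l)) (S k).head?
    obtain ⟨v₂, t₂, h₂, hs₂⟩ := @ihl emb exit hM v₁
    refine ⟨v₂, t₁ + t₂ + 1, by omega, StepsTo.head ?_ (hs₁.trans hs₂)⟩
    exact (TM2.step_of_eq (hM none) v S).trans (by simp [code, h])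
  | mono _ ht ih =>
    obtain ⟨v', t', h, hs⟩ := ih hM v
    exact ⟨v', t', h.trans ht, hs⟩

/-- The Turing machine that runs a program. -/
def machine [Fintype K] [Fintype A] [Inhabited A] (p : StackProg K A) (k₀ k₁ : K) : FinTM2 where
  K := K
  k₀ := k₀
  k₁ := k₁
  Γ _ := A
  Λ := Option p.Label
  main := some p.entry
  σ := Option A
  initialState := none
  Γk₀Fin := inferInstanceAs (Fintype A)
  m
    | some l => p.code some none l
    | none => .load (fun _ => none) .halt

/-- A function computed by a program in polynomial time is computable in polynomial time. -/
theorem nonempty_tm2ComputableInPolyTime [Fintype K] [Fintype A] [Inhabited A] {α β : Type}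
    {eα : α → List A} {eβ : β → List A} {f : α → β} (p : StackProg K A) (k₀ k₁ : K)
    (time : Polynomial ℕ)
    (h : ∀ a, Runs p (Function.update (fun _ => []) k₀ (eα a))
      (Function.update (fun _ => []) k₁ (eβ (f a))) (time.eval (eα a).length)) :
    Nonempty (TM2ComputableInPolyTime eα eβ f) := by
  refine ⟨⟨⟨p.machine k₀ k₁, Equiv.refl A, Equiv.refl A⟩, time + 1, fun a => ?_⟩⟩
  have hr := (h a).stepsTo (M := (p.machine k₀ k₁).m) (emb := some) (exit := none)
    (fun l => rfl) none
  choose v t ht hs using hr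
  refine ⟨⟨t + 1, ?_⟩, by simpa using ht⟩
  -- The extra step resets the buffer, because `haltList` requires the initial internal state; hence
  -- the bound `time + 1`.
  have hlast : StepsTo (p.machine k₀ k₁).step 1
      ⟨some none, v, Function.update (fun _ => []) k₁ (eβ (f a))⟩
      ⟨none, none, Function.update (fun _ => []) k₁ (eβ (f a))⟩ := StepsTo.single rfl
  have hi : initList (p.machine k₀ k₁) ((eα a).map (Equiv.refl A).invFun) =
      ⟨some (some p.entry), none, Function.update (fun _ => []) k₀ (eα a)⟩ :=
    TM2.Cfg.mk.injEq .. |>.mpr ⟨rfl, rfl, (initList_stk (p.machine k₀ k₁) _).trans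
      (congrArg (Function.update (β := fun _ => List A) _ k₀) (List.map_id (eα a)))⟩
  have ho : haltList (p.machine k₀ k₁) ((eβ (f a)).map (Equiv.refl A).invFun) =
      ⟨none, none, Function.update (fun _ => []) k₁ (eβ (f a))⟩ :=
    TM2.Cfg.mk.injEq .. |>.mpr ⟨rfl, rfl, (haltList_stk (p.machine k₀ k₁) _).trans
      (congrArg (Function.update (β := fun _ => List A) _ k₁) (List.map_id (eβ (f a))))⟩
  have hfin : StepsTo (p.machine k₀ k₁).step (t + 1)
      (initList (p.machine k₀ k₁) ((eα a).map (Equiv.refl A).invFun))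
      (haltList (p.machine k₀ k₁) ((eβ (f a)).map (Equiv.refl A).invFun)) := by
    rw [hi, ho]
    exact hs.trans hlast
  exact hfin

end StackProg

/-! ### Computing the description of the swap test -/

namespace QEFI

open StackProg

instance : Inhabited Sym := ⟨Sym.one⟩

/-- The unary counters of `swapTestProg`: the number of wires, the number of output qubits, and
the loop variable. -/
inductive Counter : Type
  | w | l | n
  deriving DecidableEq

/-- The stacks of `swapTestProg`: the input, the counters, a temporary stack and the output. -/
inductive Stack : Type
  | i | c (x : Counter) | t | o
  deriving DecidableEq

instance : Fintype Stack :=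
  ⟨{.i, .c .w, .c .l, .c .n, .t, .o}, fun x => by
    rcases x with _ | (_ | _ | _) | _ | _ <;> decide⟩

/-- The number `k` in unary. -/
abbrev ones (k : ℕ) : List Sym := List.replicate k Sym.one

/-- The stacks with given contents. -/
def contents (i : List Sym) (c : Counter → ℕ) (t o : List Sym) : Stack → List Sym
  | .i => i
  | .c x => ones (c x)
  | .t => t
  | .o => o

/-- The values of the counters. -/
def counters (w l n : ℕ) : Counter → ℕ
  | .w => w
  | .l => l
  | .n => n

section

variable (i : List Sym) (c : Counter → ℕ) (t o x : List Sym)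

@[simp]
theorem update_contents_i : Function.update (contents i c t o) .i x = contents x c t o := by
  funext k; cases k <;> simp [contents]

@[simp]
theorem update_contents_t : Function.update (contents i c t o) .t x = contents i c x o := by
  funext k; cases k <;> simp [contents]

@[simp]
theorem update_contents_o : Function.update (contents i c t o) .o x = contents i c t x := by
  funext k; cases k <;> simp [contents]

@[simp]
theorem update_contents_c (y : Counter) (m : ℕ) :
    Function.update (contents i c t o) (.c y) (ones m) =
      contents i (Function.update c y m) t o := by
  funext k
  rcases k with _ | z | _ | _
  · simp [contents]
  · by_cases h : z = y
    · subst h; simp [contents]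
    · simp [contents, h]
  · simp [contents]
  · simp [contents]

end

section

variable (w l n m : ℕ)

@[simp]
theorem update_counters_w : Function.update (counters w l n) .w m = counters m l n := by
  funext k; cases k <;> simp [counters]

@[simp]
theorem update_counters_l : Function.update (counters w l n) .l m = counters w m n := by
  funext k; cases k <;> simp [counters]

@[simp]
theorem update_counters_n : Function.update (counters w l n) .n m = counters w l m := by
  funext k; cases k <;> simp [counters]

end

/-! ### Stack programs that write descriptions -/

variable {i t o : List Sym} {c : Counter → ℕ}

/-- Put a copy of a counter on the output, using the temporary stack. -/
def copyProg (x : Counter) : StackProg Stack Sym :=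
  .seq (.loop (.c x) (fun _ => true) (.seq (.move (.c x) .t) (.push .o .one)))
    (.loop .t (fun _ => true) (.move .t (.c x)))

theorem runs_move_ct (x : Counter) {m : ℕ} (h : c x = m + 1) :
    Runs (.move (.c x) .t) (contents i c t o)
      (contents i (Function.update c x m) (.one :: t) o) 1 := by
  have := Runs.move (k := Stack.c x) (k' := .t) (S := contents i c t o) (a := Sym.one)
    (l := ones m) (by simp [contents, h, List.replicate_succ])
  simpa [contents] using this

theorem runs_move_tc (x : Counter) :
    Runs (.move .t (.c x)) (contents i c (.one :: t) o)
      (contents i (Function.update c x (c x + 1)) t o) 1 := by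
  have := Runs.move (k := Stack.t) (k' := .c x) (S := contents i c (.one :: t) o) (a := Sym.one)
    (l := t) (by simp [contents])
  rw [update_contents_t] at this
  exact (update_contents_c i c t o x (c x + 1)) ▸ this

theorem runs_move_cc (x y : Counter) {m : ℕ} (h : c x = m + 1) (hxy : y ≠ x) :
    Runs (.move (.c x) (.c y)) (contents i c t o)
      (contents i (Function.update (Function.update c x m) y (c y + 1)) t o) 1 := by
  have := Runs.move (k := Stack.c x) (k' := .c y) (S := contents i c t o) (a := Sym.one)
    (l := ones m) (by simp [contents, h, List.replicate_succ])
  rw [update_contents_c] at this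
  have h' := update_contents_c i (Function.update c x m) t o y (c y + 1)
  rw [← h']
  convert this using 2
  simp [contents, hxy, List.replicate_succ]

theorem runs_copyProg_out (x : Counter) (m : ℕ) (h : c x = m) (o : List Sym) (j : ℕ) :
    Runs (.loop (.c x) (fun _ => true) (.seq (.move (.c x) .t) (.push .o .one)))
      (contents i c (ones j) o)
      (contents i (Function.update c x 0) (ones (j + m)) (ones m ++ o)) (3 * m + 1) := by
  induction m generalizing c o j with
  | zero =>
    rw [Function.update_eq_self_iff.mpr h.symm]
    exact Runs.loop_done _ (by simp [contents, h])
  | succ m ih =>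
    have h₁ : Runs (.push .o .one) (contents i (Function.update c x m) (ones (j + 1)) o)
        (contents i (Function.update c x m) (ones (j + 1)) (.one :: o)) 1 := by
      simpa [contents] using Runs.push (K := Stack) .o Sym.one
        (contents i (Function.update c x m) (ones (j + 1)) o)
    have h₂ := @ih (Function.update c x m) (by simp) (.one :: o) (j + 1)
    rw [Function.update_idem, add_right_comm, add_assoc] at h₂
    have h₃ := Runs.loop_step (k := Stack.c x) (c := fun _ => true)
      (S := contents i c (ones j) o) (by simp [contents, h, List.replicate_succ])
      (Runs.seq (runs_move_ct x h) h₁) h₂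
    refine (?_ : Runs _ _ _ _).mono (le_of_eq (by ring : 1 + 1 + (3 * m + 1) + 1 = _))
    convert h₃ using 2
    rw [ones, List.replicate_succ', List.append_assoc, List.singleton_append]

theorem runs_copyProg_back (x : Counter) (j : ℕ) :
    Runs (.loop .t (fun _ => true) (.move .t (.c x))) (contents i c (ones j) o)
      (contents i (Function.update c x (c x + j)) [] o) (2 * j + 1) := by
  induction j generalizing c with
  | zero =>
    rw [add_zero, Function.update_eq_self]
    exact Runs.loop_done _ (by simp [contents])
  | succ j ih =>
    have h₂ := @ih (Function.update c x (c x + 1))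
    rw [Function.update_idem, Function.update_self, add_assoc, add_comm 1 j] at h₂
    exact (Runs.loop_step (by simp [contents]) (runs_move_tc x) h₂).mono
      (by omega)

/-- Reading a unary counter destroys it, so each symbol is also saved on the temporary stack, from
which the counter is then refilled. -/
theorem runs_copyProg (x : Counter) :
    Runs (copyProg x) (contents i c [] o) (contents i c [] (ones (c x) ++ o)) (5 * c x + 2) := by
  have h₁ := runs_copyProg_out (i := i) x (c x) rfl o 0
  have h₂ := runs_copyProg_back (i := i) (c := Function.update c x 0)
    (o := ones (c x) ++ o) x (c x)
  rw [Function.update_idem, Function.update_self, zero_add, Function.update_eq_self] at h₂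
  rw [zero_add] at h₁
  exact (Runs.seq h₁ h₂).mono (by omega)

/-- A symbol or the content of a counter. -/
inductive Token : Type
  | sym (s : Sym)
  | num (x : Counter)

/-- The string denoted by a token. -/
def Token.eval (c : Counter → ℕ) : Token → List Sym
  | sym s => [s]
  | num x => ones (c x)

/-- Put the string denoted by a list of tokens on the output. -/
def emitProg : List Token → StackProg Stack Sym
  | [] => .skip
  | .sym s :: ts => .seq (emitProg ts) (.push .o s)
  | .num x :: ts => .seq (emitProg ts) (copyProg x)

/-- The output is a stack, so the word is written from its end to its beginning and lands in front
of what was there. -/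
theorem runs_emitProg (ts : List Token) {B : ℕ} (hB : ∀ x, c x ≤ B) :
    Runs (emitProg ts) (contents i c [] o) (contents i c [] (ts.flatMap (Token.eval c) ++ o))
      (ts.length * (5 * B + 2) + 1) := by
  induction ts with
  | nil => exact (Runs.skip (contents i c [] o)).mono (by omega)
  | cons s ts ih =>
    rw [List.length_cons, add_mul, one_mul]
    cases s with
    | sym s =>
      refine (Runs.seq ih (?_ : Runs _ _ _ 1)).mono (by omega)
      simpa [contents, Token.eval] using Runs.push (K := Stack) .o s
        (contents i c [] (ts.flatMap (Token.eval c) ++ o))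
    | num x =>
      have := hB x
      refine (Runs.seq ih (?_ : Runs _ _ _ (5 * c x + 2))).mono (by omega)
      simpa [Token.eval] using runs_copyProg (i := i) x

/-- The tokens for the controlled swap of the wires `n` and `w + 1 + n`, with control `w`. -/
def cswapTokens : List Token :=
  [.sym .cnot, .num .n, .sym .sep, .num .w, .sym .one, .num .n, .sym .sep,
   .sym .toffoli, .num .w, .sym .sep, .num .w, .sym .one, .num .n, .sym .sep,
     .num .n, .sym .sep,
   .sym .cnot, .num .n, .sym .sep, .num .w, .sym .one, .num .n, .sym .sep]

/-- The description of the controlled swaps of the wires `n` and `w + 1 + n` for `n < k`, with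
control `w`. -/
def swapsString (w : ℕ) : ℕ → List Sym
  | 0 => []
  | k + 1 => cswapTokens.flatMap (Token.eval (counters w 0 k)) ++ swapsString w k

/-- Put `swapsString w l` on the output. -/
def swapsProg : StackProg Stack Sym :=
  .seq (.loop (.c .l) (fun _ => true) (.seq (emitProg cswapTokens) (.move (.c .l) (.c .n))))
    (.loop (.c .n) (fun _ => true) (.move (.c .n) (.c .l)))

/-- Loop invariant: `k` swaps are written and `r` remain. The units of the counter `l` pass to `n`,
which is both the loop index and the wire number. A round emits 23 tokens; the added 3 pays for the
empty emission, the move and the test. -/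
theorem runs_swapsProg_up (w r k : ℕ) {B : ℕ} (hw : w ≤ B) (hr : r + k ≤ B) :
    Runs (.loop (.c .l) (fun _ => true)
        (.seq (emitProg cswapTokens) (.move (.c .l) (.c .n))))
      (contents i (counters w r k) [] (swapsString w k ++ o))
      (contents i (counters w 0 (r + k)) [] (swapsString w (r + k) ++ o))
      (r * (23 * (5 * B + 2) + 3) + 1) := by
  induction r generalizing k with
  | zero =>
    rw [zero_add, zero_mul, zero_add]
    exact Runs.loop_done _ (by simp [contents, counters])
  | succ r ih =>
    have h₁ := runs_emitProg (i := i) (o := swapsString w k ++ o) (c := counters w (r + 1) k)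
      cswapTokens (B := B) (fun x => by cases x <;> simp only [counters] <;> omega)
    -- The tokens never read the counter `l`, so its current value may be replaced by `0`.
    have h₂ : cswapTokens.flatMap (Token.eval (counters w (r + 1) k)) ++
        (swapsString w k ++ o) = swapsString w (k + 1) ++ o := by
      rw [swapsString, List.append_assoc]
      rfl
    rw [h₂] at h₁
    have h₃ := runs_move_cc (i := i) (t := []) (o := swapsString w (k + 1) ++ o)
      (c := counters w (r + 1) k) .l .n (m := r) rfl (by decide)
    rw [update_counters_l, update_counters_n] at h₃
    have h₄ := ih (k + 1) (by omega)
    rw [← add_assoc, add_right_comm] at h₄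
    refine (Runs.loop_step (by simp [contents, counters, List.replicate_succ])
      (Runs.seq h₁ h₃) h₄).mono ?_
    rw [add_mul r 1]
    simp only [cswapTokens, List.length_cons, List.length_nil]
    omega

theorem runs_swapsProg_down (w r k : ℕ) :
    Runs (.loop (.c .n) (fun _ => true) (.move (.c .n) (.c .l)))
      (contents i (counters w k r) [] o) (contents i (counters w (r + k) 0) [] o)
      (2 * r + 1) := by
  induction r generalizing k with
  | zero =>
    rw [zero_add]
    exact Runs.loop_done _ (by simp [contents, counters])
  | succ r ih =>
    have h₃ := runs_move_cc (i := i) (t := []) (o := o)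
      (c := counters w k (r + 1)) .n .l (m := r) rfl (by decide)
    rw [update_counters_n, update_counters_l] at h₃
    have h₄ := ih (k + 1)
    rw [← add_assoc, add_right_comm] at h₄
    exact (Runs.loop_step (by simp [contents, counters, List.replicate_succ]) h₃ h₄).mono
      (by omega)

theorem runs_swapsProg (w l : ℕ) {B : ℕ} (hw : w ≤ B) (hl : l ≤ B) :
    Runs swapsProg (contents i (counters w l 0) [] o)
      (contents i (counters w l 0) [] (swapsString w l ++ o))
      (B * (23 * (5 * B + 2) + 5) + 2) := by
  have h₁ := runs_swapsProg_up (i := i) (o := o) w l 0 hw (by omega)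
  have h₂ := runs_swapsProg_down (i := i) (o := swapsString w l ++ o) w l 0
  refine (Runs.seq h₁ h₂).mono ?_
  have : l * (23 * (5 * B + 2) + 5) ≤ B * (23 * (5 * B + 2) + 5) := by gcongr
  linarith

theorem runs_load (x : Counter) (m : ℕ) (r : List Sym) :
    Runs (.loop .i (fun s => decide (s = Sym.one)) (.move .i (.c x)))
      (contents (ones m ++ Sym.sep :: r) c t o)
      (contents (Sym.sep :: r) (Function.update c x (c x + m)) t o) (2 * m + 1) := by
  induction m generalizing c with
  | zero =>
    rw [add_zero, Function.update_eq_self]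
    exact Runs.loop_done _ (by simp [contents])
  | succ m ih =>
    have h₁ : Runs (.move .i (.c x)) (contents (ones (m + 1) ++ Sym.sep :: r) c t o)
        (contents (ones m ++ Sym.sep :: r) (Function.update c x (c x + 1)) t o) 1 := by
      have := Runs.move (k := Stack.i) (k' := .c x)
        (S := contents (ones (m + 1) ++ Sym.sep :: r) c t o) (a := Sym.one)
        (l := ones m ++ Sym.sep :: r) (by simp [contents, List.replicate_succ])
      rw [update_contents_i] at this
      exact (update_contents_c (ones m ++ Sym.sep :: r) c t o x (c x + 1)) ▸ this
    have h₂ := @ih (Function.update c x (c x + 1))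
    rw [Function.update_idem, Function.update_self, add_assoc, add_comm 1 m] at h₂
    exact (Runs.loop_step (by simp [contents, List.replicate_succ]) h₁ h₂).mono (by omega)

theorem runs_pop_i (s : Sym) : Runs (.pop .i) (contents (s :: i) c t o) (contents i c t o) 1 := by
  simpa [contents] using Runs.pop (K := Stack) .i (contents (s :: i) c t o)

theorem runs_clear (x : Counter) (m : ℕ) (h : c x = m) :
    Runs (.loop (.c x) (fun _ => true) (.pop (.c x))) (contents i c t o)
      (contents i (Function.update c x 0) t o) (2 * m + 1) := by
  induction m generalizing c with
  | zero =>
    rw [Function.update_eq_self_iff.mpr h.symm]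
    exact Runs.loop_done _ (by simp [contents, h])
  | succ m ih =>
    have h₁ : Runs (.pop (.c x)) (contents i c t o) (contents i (Function.update c x m) t o) 1 := by
      simpa [contents, h] using Runs.pop (K := Stack) (.c x) (contents i c t o)
    have h₂ := @ih (Function.update c x m) (by simp)
    rw [Function.update_idem] at h₂
    exact (Runs.loop_step (by simp [contents, h, List.replicate_succ]) h₁ h₂).mono (by omega)

/-- The generator's gates go from input to output through the temporary stack; two reversals leave
them in order. -/
theorem runs_move_it (g t : List Sym) :
    Runs (.loop .i (fun _ => true) (.move .i .t)) (contents g c t o)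
      (contents [] c (g.reverse ++ t) o) (2 * g.length + 1) := by
  induction g generalizing t with
  | nil => exact Runs.loop_done _ (by simp [contents])
  | cons s g ih =>
    have h₁ : Runs (.move .i .t) (contents (s :: g) c t o) (contents g c (s :: t) o) 1 := by
      simpa [contents] using Runs.move (k := Stack.i) (k' := .t)
        (S := contents (s :: g) c t o) (a := s) (l := g) (by simp [contents])
    rw [List.reverse_cons, List.append_assoc, List.singleton_append, List.length_cons]
    exact (Runs.loop_step (by simp [contents]) h₁ (ih (s :: t))).mono (by omega)

theorem runs_move_to (g o : List Sym) :
    Runs (.loop .t (fun _ => true) (.move .t .o)) (contents i c g o)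
      (contents i c [] (g.reverse ++ o)) (2 * g.length + 1) := by
  induction g generalizing o with
  | nil => exact Runs.loop_done _ (by simp [contents])
  | cons s g ih =>
    have h₁ : Runs (.move .t .o) (contents i c (s :: g) o) (contents i c g (s :: o)) 1 := by
      simpa [contents] using Runs.move (k := Stack.t) (k' := .o)
        (S := contents i c (s :: g) o) (a := s) (l := g) (by simp [contents])
    rw [List.reverse_cons, List.append_assoc, List.singleton_append, List.length_cons]
    exact (Runs.loop_step (by simp [contents]) h₁ (ih (s :: o))).mono (by omega)

/-- The tokens for a negation of the wire `w`. -/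
def xTokens : List Token :=
  [.sym .h, .num .w, .sym .sep, .sym .t, .num .w, .sym .sep, .sym .t, .num .w, .sym .sep,
   .sym .t, .num .w, .sym .sep, .sym .t, .num .w, .sym .sep, .sym .h, .num .w, .sym .sep]

/-- The tokens for a Hadamard gate on the wire `w`. -/
def hTokens : List Token := [.sym .h, .num .w, .sym .sep]

/-- The tokens for a swap of the wires `0` and `w`. -/
def outTokens : List Token :=
  [.sym .cnot, .num .w, .sym .sep, .sym .sep, .sym .cnot, .sym .sep, .num .w, .sym .sep,
   .sym .cnot, .num .w, .sym .sep, .sym .sep]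

/-- The tokens for the numbers of wires, inputs and outputs of the swap test. -/
def headTokens : List Token :=
  [.num .w, .sym .one, .num .l, .sym .sep, .num .l, .sym .sep, .sym .one, .sym .sep]

/-- The description of the swap test, from the number `w` of wires, the number `l` of outputs and
the description `g` of the gates of the generator. The gates described by `mid` prepare its
input. -/
def swapTestString (mid : List Sym) (w l : ℕ) (g : List Sym) : List Sym :=
  headTokens.flatMap (Token.eval (counters w l 0)) ++
    (xTokens.flatMap (Token.eval (counters w l 0)) ++ (swapsString w l ++
      ((xTokens ++ mid.map Token.sym).flatMap (Token.eval (counters w l 0)) ++ (g ++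
        (hTokens.flatMap (Token.eval (counters w l 0)) ++ (swapsString w l ++
          (hTokens ++ outTokens).flatMap (Token.eval (counters w l 0))))))))

/-- The description of a generator. -/
def generatorString (p : ℕ × ℕ × List Sym) : List Sym :=
  encodeNum p.1 ++ (encodeNum 1 ++ (encodeNum p.2.1 ++ p.2.2))

/-- Compute the description of the swap test from that of the generator. -/
def swapTestProg (mid : List Sym) : StackProg Stack Sym :=
  .seq (.loop .i (fun s => decide (s = Sym.one)) (.move .i (.c .w))) <|
  .seq (.pop .i) <| .seq (.pop .i) <| .seq (.pop .i) <|
  .seq (.loop .i (fun s => decide (s = Sym.one)) (.move .i (.c .l))) <|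
  .seq (.pop .i) <|
  .seq (emitProg (hTokens ++ outTokens)) <|
  .seq swapsProg <|
  .seq (emitProg hTokens) <|
  .seq (.loop .i (fun _ => true) (.move .i .t)) <|
  .seq (.loop .t (fun _ => true) (.move .t .o)) <|
  .seq (emitProg (xTokens ++ mid.map Token.sym)) <|
  .seq swapsProg <|
  .seq (emitProg xTokens) <|
  .seq (emitProg headTokens) <|
  .seq (.loop (.c .w) (fun _ => true) (.pop (.c .w)))
    (.loop (.c .l) (fun _ => true) (.pop (.c .l)))

theorem runs_swapTestProg (mid : List Sym) (w l : ℕ) (g : List Sym) {B : ℕ}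
    (hB : (generatorString (w, l, g)).length ≤ B) :
    Runs (swapTestProg mid) (contents (generatorString (w, l, g)) (counters 0 0 0) [] [])
      (contents [] (counters 0 0 0) [] (swapTestString mid w l g))
      ((1000 + 10 * mid.length) * (B + 1) ^ 2) := by
  have hlen : (w + 1) + ((1 + 1) + ((l + 1) + g.length)) ≤ B := by
    simp only [generatorString, encodeNum, List.length_append, List.length_replicate,
      List.length_singleton] at hB
    exact hB
  have hc : ∀ x, counters w l 0 x ≤ B := fun x => by
    cases x <;> simp only [counters] <;> omega
  -- The word after the first unary block starts with its separator, followed by the encoding of the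
  -- single input qubit; these are the three symbols popped before the number of outputs is read.
  have h₁ := runs_load (c := counters 0 0 0) (t := []) (o := []) .w w
    (Sym.one :: Sym.sep :: (encodeNum l ++ g))
  have h₂ := runs_load (c := counters w 0 0) (t := []) (o := []) .l l g
  simp only [update_counters_w, update_counters_l, counters, zero_add] at h₁ h₂
  have hi : generatorString (w, l, g) =
      ones w ++ Sym.sep :: Sym.one :: Sym.sep :: (encodeNum l ++ g) := by
    simp [generatorString, encodeNum]
  have hi' : encodeNum l ++ g = ones l ++ Sym.sep :: g := by simp [encodeNum]
  rw [hi, hi']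
  rw [hi'] at h₁
  have h₃ := runs_emitProg (i := g) (o := []) (hTokens ++ outTokens) hc
  rw [List.append_nil] at h₃
  have e₁ := runs_move_it (c := counters w l 0)
    (o := hTokens.flatMap (Token.eval (counters w l 0)) ++ (swapsString w l ++
          (hTokens ++ outTokens).flatMap (Token.eval (counters w l 0)))) g []
  have e₂ := runs_move_to (i := []) (c := counters w l 0) (g.reverse ++ [])
    (hTokens.flatMap (Token.eval (counters w l 0)) ++ (swapsString w l ++
          (hTokens ++ outTokens).flatMap (Token.eval (counters w l 0))))
  simp only [List.append_nil, List.reverse_reverse, List.length_reverse] at e₁ e₂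
  have d₁ := runs_clear (i := []) (t := []) (o := swapTestString mid w l g)
    (c := counters w l 0) .w w rfl
  have d₂ := runs_clear (i := []) (t := []) (o := swapTestString mid w l g)
    (c := counters 0 l 0) .l l rfl
  rw [update_counters_w] at d₁
  rw [update_counters_l] at d₂
  refine (h₁.seq <| (runs_pop_i _).seq <| (runs_pop_i _).seq <| (runs_pop_i _).seq <| h₂.seq <|
    (runs_pop_i _).seq <| h₃.seq <|
    (runs_swapsProg w l (B := B) (by omega) (by omega)).seq <|
    (runs_emitProg hTokens hc).seq <| e₁.seq <| e₂.seq <|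
    (runs_emitProg (xTokens ++ mid.map Token.sym) hc).seq <|
    (runs_swapsProg w l (B := B) (by omega) (by omega)).seq <|
    (runs_emitProg xTokens hc).seq <| (runs_emitProg headTokens hc).seq <|
    d₁.seq d₂).mono ?_
  simp only [hTokens, outTokens, xTokens, headTokens, List.length_append, List.length_cons,
    List.length_nil, List.length_map]
  -- The emissions and moves cost `O(B)` and the two rounds of swaps `O(B²)`, for fixed `mid`; the
  -- constants in the bound are generous.
  nlinarith [Nat.zero_le (mid.length * B), Nat.zero_le (mid.length * B * B)]

theorem swapTestString_computable (mid : List Sym) :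
    Nonempty (Turing.TM2ComputableInPolyTime generatorString (id : List Sym → List Sym)
      fun p => swapTestString mid p.1 p.2.1 p.2.2) := by
  refine nonempty_tm2ComputableInPolyTime (swapTestProg mid) .i .o
    (.C (1000 + 10 * mid.length) * (.X + 1) ^ 2) fun p => ?_
  have h := runs_swapTestProg mid p.1 p.2.1 p.2.2 le_rfl
  have hi : contents (generatorString p) (counters 0 0 0) [] [] =
      Function.update (fun _ => []) .i (generatorString p) := by
    funext k
    rcases k with _ | (_ | _ | _) | _ | _ <;> rfl
  have ho (s : List Sym) : contents [] (counters 0 0 0) [] s =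
      Function.update (fun _ => []) .o s := by
    funext k
    rcases k with _ | (_ | _ | _) | _ | _ <;> rfl
  rw [← hi]
  simp only [id]
  rw [← ho]
  simpa using h

end QEFI

/-! ### The action of gates on vectors -/

namespace QEFI

open Matrix

theorem involutive_cnot {ι : Type} [DecidableEq ι] {c i : ι} (h : c ≠ i) :
    Function.Involutive fun x : ι → Bool => Function.update x i (xor (x i) (x c)) := by
  intro x
  simp [Function.update_of_ne h]

theorem involutive_toffoli {ι : Type} [DecidableEq ι] {c d i : ι} (hc : c ≠ i)
    (hd : d ≠ i) :
    Function.Involutive fun x : ι → Bool => Function.update x i (xor (x i) (x c && x d)) := by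
  intro x
  simp [Function.update_of_ne hc, Function.update_of_ne hd]

section Gates

variable {ι : Type} [Fintype ι] [DecidableEq ι]

/-- The unitary of a list of gates, applied from left to right. -/
noncomputable def gatesMatrix (gs : List (Gate ι)) : Matrix (ι → Bool) (ι → Bool) ℂ :=
  gs.foldl (fun U g => g.matrix * U) 1

theorem foldl_matrix_mul (gs : List (Gate ι)) (U : Matrix (ι → Bool) (ι → Bool) ℂ) :
    gs.foldl (fun U g => g.matrix * U) U = gatesMatrix gs * U := by
  induction gs generalizing U with
  | nil => simp [gatesMatrix]
  | cons g gs ih =>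
    rw [gatesMatrix, List.foldl_cons, List.foldl_cons, ih, ih (g.matrix * 1), mul_one, mul_assoc]

theorem gatesMatrix_nil : gatesMatrix ([] : List (Gate ι)) = 1 := rfl

theorem gatesMatrix_cons (g : Gate ι) (gs : List (Gate ι)) :
    gatesMatrix (g :: gs) = gatesMatrix gs * g.matrix := by
  rw [gatesMatrix, List.foldl_cons, foldl_matrix_mul, mul_one]

theorem gatesMatrix_append (gs gs' : List (Gate ι)) :
    gatesMatrix (gs ++ gs') = gatesMatrix gs' * gatesMatrix gs := by
  rw [gatesMatrix, List.foldl_append, foldl_matrix_mul, ← gatesMatrix]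

theorem gatesMatrix_cons_mulVec (g : Gate ι) (gs : List (Gate ι)) (ψ : (ι → Bool) → ℂ) :
    gatesMatrix (g :: gs) *ᵥ ψ = gatesMatrix gs *ᵥ (g.matrix *ᵥ ψ) := by
  rw [gatesMatrix_cons, mulVec_mulVec]

theorem gatesMatrix_append_mulVec (gs gs' : List (Gate ι)) (ψ : (ι → Bool) → ℂ) :
    gatesMatrix (gs ++ gs') *ᵥ ψ = gatesMatrix gs' *ᵥ (gatesMatrix gs *ᵥ ψ) := by
  rw [gatesMatrix_append, mulVec_mulVec]

/-- Circuits are evaluated through their action on amplitude functions: in row `x` only the two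
strings that agree with `x` off `i` contribute. -/
theorem onWire_mulVec (u : Matrix Bool Bool ℂ) (i : ι) (ψ : (ι → Bool) → ℂ) (x : ι → Bool) :
    (onWire u i *ᵥ ψ) x = ∑ b, u (x i) b * ψ (Function.update x i b) := by
  simp only [mulVec, dotProduct, onWire, of_apply, ite_mul, zero_mul]
  rw [← Finset.sum_filter]
  refine Finset.sum_nbij' (fun y => y i) (fun b => Function.update x i b) (by simp) ?_ ?_
    (by simp) ?_
  · intro b _
    simp only [Finset.mem_filter, Finset.mem_univ, true_and]
    intro j hj
    rw [Function.update_of_ne hj]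
  · intro y hy
    simp only [Finset.mem_filter, Finset.mem_univ, true_and] at hy
    funext j
    by_cases hj : j = i
    · subst hj; simp
    · rw [Function.update_of_ne hj, hy j hj]
  · intro y hy
    simp only [Finset.mem_filter, Finset.mem_univ, true_and] at hy
    congr 2
    funext j
    by_cases hj : j = i
    · subst hj; simp
    · rw [Function.update_of_ne hj, hy j hj]

theorem ofBasisMap_mulVec {f : (ι → Bool) → (ι → Bool)} (hf : Function.Involutive f)
    (ψ : (ι → Bool) → ℂ) (x : ι → Bool) : (ofBasisMap f *ᵥ ψ) x = ψ (f x) := by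
  simp only [mulVec, dotProduct, ofBasisMap, of_apply, ite_mul, zero_mul, one_mul]
  rw [Finset.sum_eq_single (f x)]
  · rw [if_pos (hf x).symm]
  · intro y _ hy
    rw [if_neg]
    rintro rfl
    exact hy (hf y).symm
  · simp

theorem cnot_mulVec {c i : ι} (h : c ≠ i) (ψ : (ι → Bool) → ℂ) (x : ι → Bool) :
    ((Gate.cnot c i h).matrix *ᵥ ψ) x = ψ (Function.update x i (xor (x i) (x c))) :=
  ofBasisMap_mulVec (involutive_cnot h) ψ x

theorem toffoli_mulVec {c d i : ι} (h : c ≠ d) (hc : c ≠ i) (hd : d ≠ i) (ψ : (ι → Bool) → ℂ)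
    (x : ι → Bool) :
    ((Gate.toffoli c d i h hc hd).matrix *ᵥ ψ) x =
      ψ (Function.update x i (xor (x i) (x c && x d))) :=
  ofBasisMap_mulVec (involutive_toffoli hc hd) ψ x

theorem h_mulVec (i : ι) (ψ : (ι → Bool) → ℂ) (x : ι → Bool) :
    ((Gate.h i).matrix *ᵥ ψ) x =
      (ψ (Function.update x i false) + (if x i then -1 else 1) * ψ (Function.update x i true)) /
        (Real.sqrt 2 : ℂ) := by
  rw [Gate.matrix, onWire_mulVec, Fintype.sum_bool]
  cases x i <;> simp [hGate] <;> ring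

theorem t_mulVec (i : ι) (ψ : (ι → Bool) → ℂ) (x : ι → Bool) :
    ((Gate.t i).matrix *ᵥ ψ) x =
      (if x i then Complex.exp (Complex.I * Real.pi / 4) else 1) * ψ x := by
  rw [Gate.matrix, onWire_mulVec]
  simp [tGate, diagonal_apply]

theorem sqrt_two_mul_self : (Real.sqrt 2 : ℂ) * (Real.sqrt 2 : ℂ) = 2 := by
  rw [← Complex.ofReal_mul, Real.mul_self_sqrt (by norm_num)]
  norm_num

/-- A negation of the wire `i`. -/
def notGates (i : ι) : List (Gate ι) := [.h i, .t i, .t i, .t i, .t i, .h i]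

/-- The gate set contains no negation, but `T⁴ = Z` since `e^{iπ/4}` has fourth power `-1`, and `H Z
H = X`. -/
theorem notGates_mulVec (i : ι) (ψ : (ι → Bool) → ℂ) (x : ι → Bool) :
    (gatesMatrix (notGates i) *ᵥ ψ) x = ψ (Function.update x i (!x i)) := by
  have he : Complex.exp (Complex.I * Real.pi / 4) ^ 4 = -1 := by
    rw [← Complex.exp_nat_mul, ← Complex.exp_pi_mul_I]
    congr 1
    push_cast
    ring
  have hs := sqrt_two_mul_self
  have hs0 : (Real.sqrt 2 : ℂ) ≠ 0 := by
    intro h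
    rw [h] at hs
    norm_num at hs
  simp only [notGates, gatesMatrix_cons_mulVec, gatesMatrix_nil, one_mulVec, h_mulVec, t_mulVec,
    Function.update_self, Function.update_idem, if_true, Bool.false_eq_true, if_false]
  generalize Complex.exp (Complex.I * Real.pi / 4) = e at he
  have he' : e * (e * (e * e)) = -1 := by rw [← he]; ring
  cases x i
  · field_simp
    simp
    linear_combination (ψ (Function.update x i false) - ψ (Function.update x i true)) * he' -
      ψ (Function.update x i true) * hs
  · field_simp
    simp
    linear_combination -(ψ (Function.update x i false) - ψ (Function.update x i true)) * he' -
      ψ (Function.update x i false) * hs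

/-! ### Unitarity -/

theorem onWire_conjTranspose (u : Matrix Bool Bool ℂ) (i : ι) :
    (onWire u i)ᴴ = onWire uᴴ i := by
  ext x y
  simp only [onWire, conjTranspose_apply, of_apply]
  by_cases h : ∀ j, j ≠ i → x j = y j
  · rw [if_pos h, if_pos fun j hj => (h j hj).symm]
  · rw [if_neg h, if_neg fun h' => h fun j hj => (h' j hj).symm, star_zero]

theorem onWire_mul (u v : Matrix Bool Bool ℂ) (i : ι) :
    onWire u i * onWire v i = onWire (u * v) i := by
  refine Matrix.toLin'.injective (LinearMap.ext fun ψ => funext fun x => ?_)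
  rw [toLin'_apply, toLin'_apply, ← mulVec_mulVec, onWire_mulVec, onWire_mulVec]
  simp only [onWire_mulVec, Function.update_self, Function.update_idem, mul_apply, Finset.mul_sum,
    Finset.sum_mul]
  rw [Finset.sum_comm]
  simp only [mul_assoc]

theorem onWire_one (i : ι) : onWire 1 i = (1 : Matrix (ι → Bool) (ι → Bool) ℂ) := by
  refine Matrix.toLin'.injective (LinearMap.ext fun ψ => funext fun x => ?_)
  rw [toLin'_apply, toLin'_apply, onWire_mulVec]
  simp [one_apply]

theorem hGate_conjTranspose_mul : hGateᴴ * hGate = 1 := by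
  have hs := sqrt_two_mul_self
  have hs0 : (Real.sqrt 2 : ℂ) ≠ 0 := by
    intro h
    rw [h] at hs
    norm_num at hs
  ext a b
  rw [mul_apply, Fintype.sum_bool]
  simp only [conjTranspose_apply, hGate, of_apply, star_div₀, RCLike.star_def, Complex.conj_ofReal]
  cases a <;> cases b <;> simp <;> field_simp <;> first | linear_combination -hs | ring

theorem tGate_conjTranspose_mul : tGateᴴ * tGate = 1 := by
  rw [tGate, diagonal_conjTranspose, diagonal_mul_diagonal, ← diagonal_one]
  congr 1
  funext a
  cases a
  · simp
  · have h : (starRingEnd ℂ) (Complex.I * Real.pi / 4) = -(Complex.I * Real.pi / 4) := by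
      rw [map_div₀, map_mul, Complex.conj_I, Complex.conj_ofReal, map_ofNat]
      ring
    simp only [Pi.star_apply, if_true, RCLike.star_def, ← Complex.exp_conj, ← Complex.exp_add, h]
    simp

theorem ofBasisMap_conjTranspose_mul {f : (ι → Bool) → (ι → Bool)} (hf : Function.Involutive f) :
    (ofBasisMap f)ᴴ * ofBasisMap f = 1 := by
  have h : (ofBasisMap f)ᴴ = ofBasisMap f := by
    ext x y
    simp only [conjTranspose_apply, ofBasisMap, of_apply, apply_ite star, star_one, star_zero]
    congr 1
    exact propext ⟨fun h => by rw [h, hf], fun h => by rw [h, hf]⟩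
  rw [h]
  refine Matrix.toLin'.injective (LinearMap.ext fun ψ => funext fun x => ?_)
  rw [toLin'_apply, toLin'_apply, ← mulVec_mulVec, ofBasisMap_mulVec hf, ofBasisMap_mulVec hf, hf,
    one_mulVec]

theorem Gate.matrix_conjTranspose_mul (g : Gate ι) : g.matrixᴴ * g.matrix = 1 := by
  cases g with
  | h i => rw [matrix, onWire_conjTranspose, onWire_mul, hGate_conjTranspose_mul, onWire_one]
  | t i => rw [matrix, onWire_conjTranspose, onWire_mul, tGate_conjTranspose_mul, onWire_one]
  | cnot c i h => exact ofBasisMap_conjTranspose_mul (involutive_cnot h)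
  | toffoli c d i h hc hd => exact ofBasisMap_conjTranspose_mul (involutive_toffoli hc hd)

theorem gatesMatrix_conjTranspose_mul (gs : List (Gate ι)) :
    (gatesMatrix gs)ᴴ * gatesMatrix gs = 1 := by
  induction gs with
  | nil => simp [gatesMatrix_nil]
  | cons g gs ih =>
    rw [gatesMatrix_cons, conjTranspose_mul, mul_assoc, ← mul_assoc _ᴴ (gatesMatrix gs), ih,
      one_mul, g.matrix_conjTranspose_mul]

end Gates

/-! ### Partial trace and output states -/

namespace Circuit

variable {m n : ℕ} (C : Circuit m n)

/-- The first `n` bits. -/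
def outBits (s : Fin C.wires → Bool) : Fin n → Bool := fun i => s (Fin.castLE C.out_le i)

/-- Replace the first `n` bits. -/
def setOutBits (s : Fin C.wires → Bool) (a : Fin n → Bool) : Fin C.wires → Bool :=
  fun j => if h : j.val < n then a ⟨j, h⟩ else s j

theorem setOutBits_castLE (s : Fin C.wires → Bool) (a : Fin n → Bool) (i : Fin n) :
    C.setOutBits s a (Fin.castLE C.out_le i) = a i := by
  simp [setOutBits]

theorem outBits_setOutBits (s : Fin C.wires → Bool) (a : Fin n → Bool) :
    C.outBits (C.setOutBits s a) = a :=
  funext fun i => C.setOutBits_castLE s a i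

theorem setOutBits_setOutBits_outBits (s : Fin C.wires → Bool) (a : Fin n → Bool) :
    C.setOutBits (C.setOutBits s a) (C.outBits s) = s := by
  funext j
  by_cases h : j.val < n
  · simp only [setOutBits, outBits, dif_pos h]
    rfl
  · simp [setOutBits, h]

theorem eq_setOutBits_iff (s t : Fin C.wires → Bool) (a : Fin n → Bool) :
    t = C.setOutBits s a ↔
      (∀ i, t (Fin.castLE C.out_le i) = a i) ∧ ∀ j : Fin C.wires, n ≤ j.val → s j = t j := by
  constructor
  · rintro rfl
    exact ⟨C.setOutBits_castLE s a, fun j hj => by simp [setOutBits, hj]⟩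
  · rintro ⟨h₁, h₂⟩
    funext j
    by_cases h : j.val < n
    · rw [setOutBits, dif_pos h, ← h₁ ⟨j, h⟩]
      rfl
    · rw [setOutBits, dif_neg h, h₂ j (not_lt.mp h)]

/-- The double sum becomes a single one: the kept bits of the second index are prescribed by `b` and
its traced-out bits must agree with `s`, so it is determined. -/
theorem discard_apply (M : Matrix (Fin C.wires → Bool) (Fin C.wires → Bool) ℂ)
    (a b : Fin n → Bool) :
    C.discard M a b = ∑ s, if C.outBits s = a then M s (C.setOutBits s b) else 0 := by
  simp only [discard, of_apply]
  refine Finset.sum_congr rfl fun s _ => ?_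
  by_cases h : C.outBits s = a
  · rw [if_pos h, Finset.sum_eq_single (C.setOutBits s b)]
    · rw [if_pos ⟨congrFun h, (C.eq_setOutBits_iff s _ b).mp rfl⟩]
    · intro t _ ht
      exact if_neg fun h' => ht ((C.eq_setOutBits_iff s t b).mpr h'.2)
    · simp
  · rw [if_neg h]
    exact Finset.sum_eq_zero fun t _ => if_neg fun h' => h (funext h'.1)

/-- The isometry computed by the circuit before wires are discarded. -/
noncomputable def iso : Matrix (Fin C.wires → Bool) (Fin m → Bool) ℂ := C.unitary * C.prepare

theorem iso_apply (s : Fin C.wires → Bool) (a : Fin m → Bool) :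
    C.iso s a = (gatesMatrix C.gates *ᵥ fun t => C.prepare t a) s := rfl

theorem prepare_conjTranspose_mul : C.prepareᴴ * C.prepare = 1 := by
  -- Viewing the input wires as the outputs of an auxiliary circuit lets `setOutBits` describe the
  -- prepared string: `a` written over zeros.
  let D : Circuit 0 m := ⟨C.wires, Nat.zero_le _, C.in_le, []⟩
  have h (s : Fin C.wires → Bool) (a : Fin m → Bool) :
      C.prepare s a = if s = D.setOutBits (fun _ => false) a then 1 else 0 := by
    simp only [prepare, of_apply]
    congr 1
    refine propext (Iff.trans ?_ (D.eq_setOutBits_iff _ s a).symm)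
    simp only [eq_comm (a := false)]
    rfl
  ext a b
  rw [mul_apply, one_apply]
  simp only [conjTranspose_apply, h]
  rw [Finset.sum_eq_single (D.setOutBits (fun _ => false) b)]
  · rw [if_pos rfl, mul_one]
    by_cases hab : a = b
    · subst hab; simp
    · rw [if_neg hab, if_neg, star_zero]
      intro h'
      have := congrArg D.outBits h'
      rw [outBits_setOutBits, outBits_setOutBits] at this
      exact hab this.symm
  · intro s _ hs
    rw [if_neg hs, mul_zero]
  · simp

theorem iso_conjTranspose_mul : C.isoᴴ * C.iso = 1 := by
  have : C.unitaryᴴ * C.unitary = 1 := gatesMatrix_conjTranspose_mul C.gates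
  rw [iso, conjTranspose_mul, Matrix.mul_assoc, ← Matrix.mul_assoc C.unitaryᴴ, this,
    Matrix.one_mul, prepare_conjTranspose_mul]

theorem sum_iso_mul_star (a : Fin m → Bool) : ∑ s, C.iso s a * star (C.iso s a) = 1 := by
  have := congrFun (congrFun C.iso_conjTranspose_mul a) a
  rw [mul_apply, one_apply_eq] at this
  rw [← this]
  exact Finset.sum_congr rfl fun s _ => mul_comm _ _

end Circuit

theorem Circuit.run_basisState {n : ℕ} (C : Circuit 1 n) (b : Bool) (a a' : Fin n → Bool) :
    C.run (basisState b) a a' = ∑ s, if C.outBits s = a then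
      C.iso s (fun _ => b) * star (C.iso (C.setOutBits s a') (fun _ => b)) else 0 := by
  rw [run, discard_apply]
  have h (s t : Fin C.wires → Bool) :
      (C.iso * basisState b * C.isoᴴ) s t = C.iso s (fun _ => b) * star (C.iso t (fun _ => b)) := by
    rw [mul_apply, Finset.sum_eq_single fun _ => b]
    · simp [basisState]
    · intro c _ hc
      simp [basisState, mul_single_apply_of_ne, hc]
    · simp
  exact Finset.sum_congr rfl fun s _ => by rw [← iso, h]

theorem Circuit.trace_run_basisState {n : ℕ} (C : Circuit 1 n) (b : Bool) :
    (C.run (basisState b)).trace = 1 := by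
  simp only [trace, diag_apply, run_basisState]
  rw [Finset.sum_comm, ← C.sum_iso_mul_star fun _ => b]
  refine Finset.sum_congr rfl fun s _ => ?_
  rw [Finset.sum_ite_eq, if_pos (Finset.mem_univ _)]
  have : C.setOutBits s (C.outBits s) = s :=
    ((C.eq_setOutBits_iff s s _).mpr ⟨fun _ => rfl, fun _ _ => rfl⟩).symm
  rw [this]

theorem Circuit.isHermitian_run_basisState {n : ℕ} (C : Circuit 1 n) (b : Bool) :
    (C.run (basisState b)).IsHermitian := by
  ext a a'
  simp only [conjTranspose_apply, run_basisState, star_sum,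
    ← Finset.sum_filter]
  -- Conjugation exchanges the two indices; `s` with kept bits `a'` is matched with the string that
  -- has the same discarded bits and kept bits `a`.
  refine Finset.sum_nbij' (fun s => C.setOutBits s a) (fun s => C.setOutBits s a') ?_ ?_ ?_ ?_ ?_
  · simp [outBits_setOutBits]
  · simp [outBits_setOutBits]
  · intro s hs
    simp only [Finset.mem_filter, Finset.mem_univ, true_and] at hs
    rw [← hs, setOutBits_setOutBits_outBits]
  · intro s hs
    simp only [Finset.mem_filter, Finset.mem_univ, true_and] at hs
    rw [← hs, setOutBits_setOutBits_outBits]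
  · intro s hs
    simp only [Finset.mem_filter, Finset.mem_univ, true_and] at hs
    rw [star_mul, star_star, ← hs, setOutBits_setOutBits_outBits]

end QEFI

/-! ### The swap test -/

namespace QEFI

open Matrix

/-! ### The wires of the swap test -/

section Wires

variable {w l : ℕ}

/-- The wires of the generator in the swap test. -/
def genWire (i : Fin w) : Fin (w + 1 + l) := Fin.castAdd l (Fin.castAdd 1 i)

/-- The control wire of the swap test. -/
def ancWire : Fin (w + 1 + l) := Fin.castAdd l (Fin.natAdd w 0)

/-- The wires of the swap test that store its input. -/
def testWire (i : Fin l) : Fin (w + 1 + l) := Fin.natAdd (w + 1) i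

theorem genWire_injective : Function.Injective (genWire : Fin w → Fin (w + 1 + l)) :=
  fun i j h => Fin.ext (by simpa [genWire] using congrArg Fin.val h)

theorem genWire_ne_ancWire (i : Fin w) : (genWire i : Fin (w + 1 + l)) ≠ ancWire := by
  intro h
  have := congrArg Fin.val h
  simp [genWire, ancWire] at this
  omega

theorem genWire_ne_testWire (i : Fin w) (j : Fin l) : genWire i ≠ testWire j := by
  intro h
  have := congrArg Fin.val h
  simp [genWire, testWire] at this
  omega

theorem ancWire_ne_testWire (j : Fin l) : (ancWire : Fin (w + 1 + l)) ≠ testWire j := by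
  intro h
  have := congrArg Fin.val h
  simp [ancWire, testWire] at this
  omega

/-- The basis state with given parts. -/
def glue (s : Fin w → Bool) (z : Bool) (a : Fin l → Bool) : Fin (w + 1 + l) → Bool :=
  Fin.append (Fin.append s fun _ : Fin 1 => z) a

@[elab_as_elim]
theorem wire_cases {P : Fin (w + 1 + l) → Prop} (h₁ : ∀ i, P (genWire i)) (h₂ : P ancWire)
    (h₃ : ∀ i, P (testWire i)) (i : Fin (w + 1 + l)) : P i :=
  Fin.addCases (fun i => Fin.addCases h₁ (fun j => by rwa [Subsingleton.elim j 0]) i) h₃ i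

variable (s : Fin w → Bool) (z : Bool) (a : Fin l → Bool)

@[simp]
theorem glue_genWire (i : Fin w) : glue s z a (genWire i) = s i := by
  simp [glue, genWire]

@[simp]
theorem glue_ancWire : glue s z a ancWire = z := by
  rw [glue, ancWire, Fin.append_left, Fin.append_right]

@[simp]
theorem glue_testWire (i : Fin l) : glue s z a (testWire i) = a i := by
  simp [glue, testWire]

@[simp]
theorem update_glue_genWire (i : Fin w) (b : Bool) :
    Function.update (glue s z a) (genWire i) b = glue (Function.update s i b) z a := by
  funext j
  refine wire_cases (fun k => ?_) ?_ (fun k => ?_) j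
  · by_cases h : k = i
    · subst h; simp
    · rw [Function.update_of_ne (genWire_injective.ne h)]; simp [h]
  · rw [Function.update_of_ne (genWire_ne_ancWire i).symm]; simp
  · rw [Function.update_of_ne (genWire_ne_testWire i k).symm]; simp

@[simp]
theorem update_glue_ancWire (b : Bool) :
    Function.update (glue s z a) ancWire b = glue s b a := by
  funext j
  refine wire_cases (fun k => ?_) ?_ (fun k => ?_) j
  · rw [Function.update_of_ne (genWire_ne_ancWire k)]; simp
  · simp
  · rw [Function.update_of_ne (ancWire_ne_testWire k).symm]; simp

@[simp]
theorem update_glue_testWire (i : Fin l) (b : Bool) :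
    Function.update (glue s z a) (testWire i) b = glue s z (Function.update a i b) := by
  funext j
  refine wire_cases (fun k => ?_) ?_ (fun k => ?_) j
  · rw [Function.update_of_ne (genWire_ne_testWire k i)]; simp
  · rw [Function.update_of_ne (ancWire_ne_testWire i)]; simp
  · by_cases h : k = i
    · subst h; simp
    · rw [Function.update_of_ne]
      · simp [h]
      · intro h'
        exact h (Fin.ext (by simpa [testWire] using congrArg Fin.val h'))

theorem glue_parts (x : Fin (w + 1 + l) → Bool) :
    glue (fun i => x (genWire i)) (x ancWire) (fun i => x (testWire i)) = x := by
  funext j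
  refine wire_cases (fun k => ?_) ?_ (fun k => ?_) j <;> simp

theorem sum_glue (F : (Fin (w + 1 + l) → Bool) → ℂ) :
    ∑ x, F x = ∑ z, ∑ s, ∑ a, F (glue s z a) := by
  let e : Bool × (Fin w → Bool) × (Fin l → Bool) ≃ (Fin (w + 1 + l) → Bool) :=
    { toFun := fun p => glue p.2.1 p.1 p.2.2
      invFun := fun x => (x ancWire, fun i => x (genWire i), fun i => x (testWire i))
      left_inv := fun p => by simp
      right_inv := glue_parts }
  rw [← e.sum_comp F, Fintype.sum_prod_type]
  simp only [Fintype.sum_prod_type]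
  rfl

end Wires

/-- Rename the wires of a gate. -/
def Gate.map {ι κ : Type} (f : ι → κ) (hf : Function.Injective f) : Gate ι → Gate κ
  | .h i => .h (f i)
  | .t i => .t (f i)
  | .cnot c i hci => .cnot (f c) (f i) (hf.ne hci)
  | .toffoli c d i hcd hci hdi =>
    .toffoli (f c) (f d) (f i) (hf.ne hcd) (hf.ne hci) (hf.ne hdi)

/-- The generator acts with the control bit and the stored input as mere parameters. -/
theorem map_genWire_mulVec {w l : ℕ} (gs : List (Gate (Fin w)))
    (ψ : (Fin (w + 1 + l) → Bool) → ℂ) (s : Fin w → Bool) (z : Bool) (a : Fin l → Bool) :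
    (gatesMatrix (gs.map (Gate.map genWire genWire_injective)) *ᵥ ψ) (glue s z a) =
      (gatesMatrix gs *ᵥ fun t => ψ (glue t z a)) s := by
  induction gs generalizing ψ with
  | nil => simp [gatesMatrix_nil]
  | cons g gs ih =>
    rw [List.map_cons, gatesMatrix_cons_mulVec, gatesMatrix_cons_mulVec, ih]
    congr 2
    funext t
    cases g with
    | h i => simp [Gate.map, h_mulVec]
    | t i => simp [Gate.map, t_mulVec]
    | cnot c i h => simp [Gate.map, cnot_mulVec]
    | toffoli c d i h hc hd => simp [Gate.map, toffoli_mulVec]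

/-! ### The gates of the swap test and its amplitudes -/

namespace Circuit

variable {l : ℕ} (C : Circuit 1 l)

/-- The swap of an output wire of the generator and the corresponding input wire, controlled by
the control wire. -/
def cswapGates (i : Fin l) : List (Gate (Fin (C.wires + 1 + l))) :=
  [.cnot (genWire (Fin.castLE C.out_le i)) (testWire i) (genWire_ne_testWire _ _),
   .toffoli ancWire (testWire i) (genWire (Fin.castLE C.out_le i)) (ancWire_ne_testWire _)
     (genWire_ne_ancWire _).symm (genWire_ne_testWire _ _).symm,
   .cnot (genWire (Fin.castLE C.out_le i)) (testWire i) (genWire_ne_testWire _ _)]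

/-- A swap is three CNOTs, and it suffices to control the middle one: without it the outer two
cancel. -/
theorem cswapGates_mulVec (i : Fin l) (ψ : (Fin (C.wires + 1 + l) → Bool) → ℂ)
    (s : Fin C.wires → Bool) (z : Bool) (a : Fin l → Bool) :
    (gatesMatrix (C.cswapGates i) *ᵥ ψ) (glue s z a) =
      ψ (glue (Function.update s (Fin.castLE C.out_le i)
          (if z then a i else s (Fin.castLE C.out_le i))) z
        (Function.update a i (if z then s (Fin.castLE C.out_le i) else a i))) := by
  simp only [cswapGates, gatesMatrix_cons_mulVec, gatesMatrix_nil, one_mulVec, cnot_mulVec,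
    toffoli_mulVec, glue_genWire, glue_testWire, glue_ancWire, update_glue_genWire,
    update_glue_testWire, Function.update_self, Function.update_idem]
  cases z <;> cases s (Fin.castLE C.out_le i) <;> cases a i <;> rfl

/-- The controlled swaps of the first `k` output wires of the generator and the corresponding
input wires. -/
def swapGates : ∀ k, k ≤ l → List (Gate (Fin (C.wires + 1 + l)))
  | 0, _ => []
  | k + 1, h => C.cswapGates ⟨k, h⟩ ++ swapGates k (Nat.le_of_succ_le h)

theorem swapGates_mulVec_of_le (k : ℕ) (hk : k ≤ l) (ψ : (Fin (C.wires + 1 + l) → Bool) → ℂ)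
    (s : Fin C.wires → Bool) (z : Bool) (a : Fin l → Bool) :
    (gatesMatrix (C.swapGates k hk) *ᵥ ψ) (glue s z a) =
      ψ (glue (fun j => if h : z = true ∧ j.val < k then a ⟨j, h.2.trans_le hk⟩ else s j) z
        (fun j => if z = true ∧ j.val < k then s (Fin.castLE C.out_le j) else a j)) := by
  induction k generalizing ψ with
  | zero => simp [swapGates, gatesMatrix_nil]
  | succ k ih =>
    rw [swapGates, gatesMatrix_append_mulVec, ih, cswapGates_mulVec]
    congr 2
    · funext j
      by_cases hj : j = Fin.castLE C.out_le ⟨k, hk⟩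
      · subst hj
        cases z <;> simp
      · have : j.val ≠ k := fun h => hj (Fin.ext h)
        rw [Function.update_of_ne hj]
        have h' : j.val < k + 1 ↔ j.val < k := by omega
        simp only [h']
    · funext j
      by_cases hj : j = ⟨k, hk⟩
      · subst hj
        cases z <;> simp
      · have : j.val ≠ k := fun h => hj (Fin.ext h)
        rw [Function.update_of_ne hj]
        have h' : j.val < k + 1 ↔ j.val < k := by omega
        simp only [h']

theorem swapGates_mulVec_false (ψ : (Fin (C.wires + 1 + l) → Bool) → ℂ)
    (s : Fin C.wires → Bool) (a : Fin l → Bool) :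
    (gatesMatrix (C.swapGates l le_rfl) *ᵥ ψ) (glue s false a) = ψ (glue s false a) := by
  simp [swapGates_mulVec_of_le]

theorem swapGates_mulVec_true (ψ : (Fin (C.wires + 1 + l) → Bool) → ℂ)
    (s : Fin C.wires → Bool) (a : Fin l → Bool) :
    (gatesMatrix (C.swapGates l le_rfl) *ᵥ ψ) (glue s true a) =
      ψ (glue (C.setOutBits s a) true (C.outBits s)) := by
  simp only [swapGates_mulVec_of_le, true_and, Fin.is_lt, if_true]
  rfl

/-- The first wire of the generator. -/
def firstWire : Fin C.wires := ⟨0, C.in_le⟩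

/-- The swap of the control wire and the first wire. -/
def outGates : List (Gate (Fin (C.wires + 1 + l))) :=
  [.cnot ancWire (genWire C.firstWire) (genWire_ne_ancWire _).symm,
   .cnot (genWire C.firstWire) ancWire (genWire_ne_ancWire _),
   .cnot ancWire (genWire C.firstWire) (genWire_ne_ancWire _).symm]

/-- Exchange the bits on the control wire and on the first wire. -/
def exchange (x : Fin (C.wires + 1 + l) → Bool) : Fin (C.wires + 1 + l) → Bool :=
  Function.update (Function.update x (genWire C.firstWire) (x ancWire)) ancWire
    (x (genWire C.firstWire))

theorem exchange_involutive : Function.Involutive C.exchange := by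
  intro x
  rw [← glue_parts x]
  simp [exchange]

/-- Three CNOTs swap two wires. This is needed because a circuit's output is read from its first
wire, while the test's result is on the control wire. -/
theorem outGates_mulVec (ψ : (Fin (C.wires + 1 + l) → Bool) → ℂ)
    (x : Fin (C.wires + 1 + l) → Bool) :
    (gatesMatrix C.outGates *ᵥ ψ) x = ψ (C.exchange x) := by
  rw [← glue_parts x]
  generalize (fun i => x (genWire i)) = s
  generalize x ancWire = z
  simp only [exchange, outGates, gatesMatrix_cons_mulVec, gatesMatrix_nil, one_mulVec, cnot_mulVec,
    glue_genWire, glue_ancWire, update_glue_genWire, update_glue_ancWire, Function.update_self,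
    Function.update_idem]
  cases z <;> cases s C.firstWire <;> rfl

/-- The gates of the swap test before the generator runs: they move the input to its place. -/
def loadGates : List (Gate (Fin (C.wires + 1 + l))) :=
  notGates ancWire ++ (C.swapGates l le_rfl ++ notGates ancWire)

/-- The gates that prepare the input `b` of the generator. -/
def inputGates (b : Bool) : List (Gate (Fin (C.wires + 1 + l))) :=
  if b then notGates (genWire C.firstWire) else []

/-- The gates of the generator, in the swap test. -/
def generatorGates : List (Gate (Fin (C.wires + 1 + l))) :=
  C.gates.map (Gate.map genWire genWire_injective)

/-- The swap test of an input state and the output of `C` on input `b`. -/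
def swapTest (b : Bool) : Circuit l 1 where
  wires := C.wires + 1 + l
  in_le := by omega
  out_le := by omega
  gates := C.loadGates ++ (C.inputGates b ++ (C.generatorGates ++
    ([Gate.h ancWire] ++ (C.swapGates l le_rfl ++ ([Gate.h ancWire] ++ C.outGates)))))

theorem prepare_eq_ite {m n : ℕ} (C : Circuit m n) (x : Fin C.wires → Bool) (a : Fin m → Bool)
    {P : Prop} [Decidable P] (h : ((∀ i, x (Fin.castLE C.in_le i) = a i) ∧
      ∀ j : Fin C.wires, m ≤ j.val → x j = false) ↔ P) :
    C.prepare x a = if P then 1 else 0 :=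
  if_congr h rfl rfl

theorem prepare_swapTest_glue (b : Bool) (s : Fin C.wires → Bool) (z : Bool) (a a' : Fin l → Bool) :
    (C.swapTest b).prepare (glue s z a') a =
      if C.outBits s = a ∧ (∀ j : Fin C.wires, l ≤ j.val → s j = false) ∧ z = false ∧
        a' = fun _ => false then 1 else 0 := by
  refine (C.swapTest b).prepare_eq_ite (glue s z a') a (and_congr ?_ ?_)
  · rw [funext_iff]
    refine forall_congr' fun i => ?_
    rw [outBits, ← glue_genWire s z a' (Fin.castLE C.out_le i)]
    rfl
  · constructor
    · intro h
      refine ⟨fun j hj => ?_, ?_, ?_⟩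
      · have := h (genWire j) (by simpa [genWire] using hj)
        rwa [glue_genWire] at this
      · have := h ancWire (by simpa [ancWire] using C.out_le)
        rwa [glue_ancWire] at this
      · funext j
        have := h (testWire j) (by have := C.out_le; simp [testWire]; omega)
        rwa [glue_testWire] at this
    · rintro ⟨h₁, h₂, h₃⟩ j
      refine wire_cases (fun k => ?_) ?_ (fun k => ?_) j
      · intro hk
        rw [glue_genWire]
        exact h₁ k (by simpa [genWire] using hk)
      · intro _
        rw [glue_ancWire, h₂]
      · intro _
        rw [glue_testWire, h₃]

/-- The input arrives on the first `l` wires, where the generator expects its own blank wires.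
Negating the control turns the controlled swaps into plain ones, which carry the input to the test
wires; the second negation resets the control to zero. Thus the same gates serve for loading and for
testing. -/
theorem loadGates_mulVec (b : Bool) (s : Fin C.wires → Bool) (z : Bool) (a a' : Fin l → Bool) :
    (gatesMatrix C.loadGates *ᵥ fun x => (C.swapTest b).prepare x a) (glue s z a') =
      if z = false ∧ a' = a then (if s = fun _ => false then 1 else 0) else 0 := by
  rw [loadGates, gatesMatrix_append_mulVec, gatesMatrix_append_mulVec, notGates_mulVec,
    glue_ancWire, update_glue_ancWire]
  cases z
  · rw [Bool.not_false, swapGates_mulVec_true, notGates_mulVec, glue_ancWire,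
      update_glue_ancWire, prepare_swapTest_glue, outBits_setOutBits]
    simp only [Bool.not_true, true_and]
    rw [← ite_and]
    congr 1
    refine propext (and_congr_right fun _ => ?_)
    constructor
    · rintro ⟨h₁, h₂⟩
      funext j
      by_cases hj : j.val < l
      · exact congrFun h₂ ⟨j, hj⟩
      · have := h₁ j (not_lt.mp hj)
        rwa [setOutBits, dif_neg hj] at this
    · rintro rfl
      exact ⟨fun j hj => by simp [setOutBits, not_lt.mpr hj], rfl⟩
  · rw [Bool.not_true, swapGates_mulVec_false, notGates_mulVec, glue_ancWire,
      update_glue_ancWire, prepare_swapTest_glue]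
    simp

theorem prepare_apply_const (b : Bool) (s : Fin C.wires → Bool) :
    C.prepare s (fun _ => b) =
      if s = Function.update (fun _ => false) C.firstWire b then 1 else 0 := by
  simp only [prepare, of_apply]
  congr 1
  refine propext ⟨fun ⟨h₁, h₂⟩ => ?_, ?_⟩
  · funext j
    by_cases hj : j = C.firstWire
    · subst hj
      rw [Function.update_self]
      exact h₁ 0
    · rw [Function.update_of_ne hj]
      refine h₂ j (Nat.one_le_iff_ne_zero.mpr fun h => hj (Fin.ext h))
  · rintro rfl
    refine ⟨fun i => ?_, fun j hj => ?_⟩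
    · have : Fin.castLE C.in_le i = C.firstWire := Fin.ext (by simp [firstWire])
      rw [this, Function.update_self]
    · rw [Function.update_of_ne]
      rintro rfl
      simp [firstWire] at hj

theorem inputGates_mulVec (b : Bool) (ψ : (Fin (C.wires + 1 + l) → Bool) → ℂ) (a : Fin l → Bool)
    (hψ : ∀ s z a', ψ (glue s z a') =
      if z = false ∧ a' = a then (if s = fun _ => false then 1 else 0) else 0)
    (s : Fin C.wires → Bool) (z : Bool) (a' : Fin l → Bool) :
    (gatesMatrix (C.inputGates b) *ᵥ ψ) (glue s z a') =
      if z = false ∧ a' = a then C.prepare s (fun _ => b) else 0 := by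
  rw [prepare_apply_const]
  cases b
  · rw [Function.update_eq_self_iff.mpr rfl]
    simp [inputGates, gatesMatrix_nil, hψ]
  · rw [inputGates, if_pos rfl, notGates_mulVec, glue_genWire, update_glue_genWire, hψ]
    congr 2
    refine propext ⟨fun h => ?_, ?_⟩
    · funext j
      by_cases hj : j = C.firstWire
      · subst hj
        have := congrFun h C.firstWire
        rw [Function.update_self] at this ⊢
        simpa using this
      · have := congrFun h j
        rw [Function.update_of_ne hj] at this ⊢
        exact this
    · rintro rfl
      rw [Function.update_self, Function.update_idem]
      simp

theorem generatorGates_mulVec (b : Bool) (ψ : (Fin (C.wires + 1 + l) → Bool) → ℂ)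
    (a : Fin l → Bool)
    (hψ : ∀ s z a', ψ (glue s z a') = if z = false ∧ a' = a then C.prepare s (fun _ => b) else 0)
    (s : Fin C.wires → Bool) (z : Bool) (a' : Fin l → Bool) :
    (gatesMatrix C.generatorGates *ᵥ ψ) (glue s z a') =
      if z = false ∧ a' = a then C.iso s (fun _ => b) else 0 := by
  rw [generatorGates, map_genWire_mulVec]
  simp only [hψ]
  split_ifs
  · rfl
  · exact congrFun (mulVec_zero _) s

/-- The amplitude of `|s⟩|1⟩|a'⟩` in the state before the output is moved to the first wire. -/
noncomputable def amplitude (b : Bool) (a : Fin l → Bool) (s : Fin C.wires → Bool)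
    (a' : Fin l → Bool) : ℂ :=
  ((if a' = a then C.iso s (fun _ => b) else 0) -
    if C.outBits s = a then C.iso (C.setOutBits s a') (fun _ => b) else 0) / 2

/-- Conjugating a controlled swap by Hadamards on the control sends `|0⟩ψ` to a state whose
component at control `1` is `(ψ - swap ψ) / 2`, the antisymmetric part. The two factors `1 / √2`
give the denominator, and the exchange undoes the final move of the control to the first wire. -/
theorem iso_swapTest (b : Bool) (a : Fin l → Bool) (x : Fin (C.wires + 1 + l) → Bool)
    {s : Fin C.wires → Bool} {a' : Fin l → Bool} (hx : C.exchange x = glue s true a') :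
    (C.swapTest b).iso x a = C.amplitude b a s a' := by
  refine ((C.swapTest b).iso_apply x a).trans ?_
  have key (ψ : (Fin (C.wires + 1 + l) → Bool) → ℂ) : gatesMatrix (C.loadGates ++
      (C.inputGates b ++ (C.generatorGates ++ ([Gate.h ancWire] ++ (C.swapGates l le_rfl ++
        ([Gate.h ancWire] ++ C.outGates)))))) *ᵥ ψ = gatesMatrix C.outGates *ᵥ
      (gatesMatrix [Gate.h ancWire] *ᵥ (gatesMatrix (C.swapGates l le_rfl) *ᵥ
        (gatesMatrix [Gate.h ancWire] *ᵥ (gatesMatrix C.generatorGates *ᵥ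
          (gatesMatrix (C.inputGates b) *ᵥ (gatesMatrix C.loadGates *ᵥ ψ)))))) := by
    simp only [gatesMatrix_append_mulVec]
  refine (congrFun (key fun t => (C.swapTest b).prepare t a) x).trans ?_
  rw [outGates_mulVec, hx, gatesMatrix_cons_mulVec, gatesMatrix_nil, one_mulVec, h_mulVec,
    glue_ancWire, update_glue_ancWire, update_glue_ancWire, swapGates_mulVec_false,
    swapGates_mulVec_true, gatesMatrix_cons_mulVec, gatesMatrix_nil, one_mulVec, h_mulVec,
    h_mulVec]
  simp only [glue_ancWire, update_glue_ancWire]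
  have h := C.generatorGates_mulVec b _ a (C.inputGates_mulVec b _ a
    fun s z a' => C.loadGates_mulVec b s z a a')
  rw [h, h, h, h, amplitude]
  have hs := sqrt_two_mul_self
  have hs0 : (Real.sqrt 2 : ℂ) ≠ 0 := by
    intro h
    rw [h] at hs
    norm_num at hs
  simp only [true_and, Bool.true_eq_false, false_and, if_false, mul_zero, add_zero, if_true,
    Bool.false_eq_true]
  generalize (if a' = a then C.iso s (fun _ => b) else 0) = p
  generalize (if C.outBits s = a then C.iso (C.setOutBits s a') (fun _ => b) else 0) = q
  rw [div_add' _ _ _ hs0, div_div, hs]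
  congr 1
  field_simp
  ring

theorem acceptProb_swapTest_eq_sum (b : Bool) (ρ : Matrix (Fin l → Bool) (Fin l → Bool) ℂ) :
    (C.swapTest b).acceptProb ρ = (∑ s, ∑ a', ∑ a₁, ∑ a₂,
      C.amplitude b a₁ s a' * ρ a₁ a₂ * star (C.amplitude b a₂ s a')).re := by
  have hM (x y) : ((C.swapTest b).iso * ρ * (C.swapTest b).isoᴴ) x y = ∑ a₁, ∑ a₂,
      (C.swapTest b).iso x a₁ * ρ a₁ a₂ * star ((C.swapTest b).iso y a₂) := by
    rw [mul_apply, Finset.sum_comm]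
    simp only [mul_apply, Finset.sum_mul, conjTranspose_apply]
  have hout (x : Fin (C.wires + 1 + l) → Bool) :
      (C.swapTest b).outBits x = (fun _ => true) ↔ C.exchange x ancWire = true := by
    rw [exchange, Function.update_self, funext_iff]
    exact ⟨fun h => h 0, fun h i => by rw [Subsingleton.elim i 0]; exact h⟩
  rw [acceptProb, run, discard_apply]
  congr 1
  refine Eq.trans (b := ∑ x : Fin (C.wires + 1 + l) → Bool,
    if C.exchange x ancWire = true then ∑ a₁, ∑ a₂,
      (C.swapTest b).iso x a₁ * ρ a₁ a₂ * star ((C.swapTest b).iso x a₂) else 0) ?_ ?_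
  · refine Finset.sum_congr rfl fun x _ => ?_
    by_cases h : C.exchange x ancWire = true
    · have h' := (hout x).mpr h
      have hx : (C.swapTest b).setOutBits x (fun _ => true) = x :=
        (((C.swapTest b).eq_setOutBits_iff x x _).mpr ⟨congrFun h', fun _ _ => rfl⟩).symm
      rw [if_pos h, if_pos h', hx]
      exact hM x x
    · rw [if_neg h, if_neg fun h' => h ((hout x).mp h')]
  -- Reindexing by the exchange turns acceptance into the condition that the control bit is `1`.
  · rw [← Equiv.sum_comp (Function.Involutive.toPerm C.exchange C.exchange_involutive), sum_glue, Fintype.sum_bool]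
    have hE (x) : C.exchange (Function.Involutive.toPerm C.exchange C.exchange_involutive x) = x :=
      C.exchange_involutive x
    simp only [hE, glue_ancWire, if_true, Bool.false_eq_true, if_false, Finset.sum_const_zero,
      add_zero]
    refine Finset.sum_congr rfl fun s _ => Finset.sum_congr rfl fun a' _ => ?_
    simp only [fun a => C.iso_swapTest b a _ (hE (glue s true a'))]

end Circuit

end QEFI

namespace QEFI

open Matrix

/-! ### The acceptance probability of the swap test -/

/-- As a function of the input basis state, an amplitude of the test is supported on two values, so
the quadratic form in `ρ` has two diagonal and two cross terms. -/
theorem sum_sum_single_sub_single {κ : Type} [Fintype κ] [DecidableEq κ] (ρ : Matrix κ κ ℂ)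
    (x y : κ) (u v : ℂ) :
    ∑ a, ∑ b, (((if x = a then u else 0) - if y = a then v else 0) / 2) * ρ a b *
      star (((if x = b then u else 0) - if y = b then v else 0) / 2) =
    ((u * star u * ρ x x + v * star v * ρ y y) -
      (u * star v * ρ x y + v * star u * ρ y x)) / 4 := by
  have h (a : κ) (c : ℂ) : ∑ b, c * ρ a b *
      star (((if x = b then u else 0) - if y = b then v else 0) / 2) =
      c * ((ρ a x * star u - ρ a y * star v) / 2) := by
    have h' (b : κ) : c * ρ a b * star (((if x = b then u else 0) - if y = b then v else 0) / 2) =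
        (if x = b then c * ρ a b * star u / 2 else 0) -
          if y = b then c * ρ a b * star v / 2 else 0 := by
      rw [star_div₀, star_sub, apply_ite star, apply_ite star, star_zero, star_ofNat]
      split_ifs <;> ring
    simp only [h', Finset.sum_sub_distrib, Finset.sum_ite_eq, Finset.mem_univ, if_true]
    ring
  simp only [h]
  have h' (a : κ) : (((if x = a then u else 0) - if y = a then v else 0) / 2) *
      ((ρ a x * star u - ρ a y * star v) / 2) =
      (if x = a then u * ((ρ a x * star u - ρ a y * star v) / 4) else 0) -
        if y = a then v * ((ρ a x * star u - ρ a y * star v) / 4) else 0 := by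
    split_ifs <;> ring
  simp only [h', Finset.sum_sub_distrib, Finset.sum_ite_eq, Finset.mem_univ, if_true]
  ring

namespace Circuit

variable {l : ℕ} (C : Circuit 1 l)

theorem sum_comp_exchange_out (G : (Fin C.wires → Bool) → (Fin l → Bool) → ℂ) :
    ∑ s, ∑ a, G (C.setOutBits s a) (C.outBits s) = ∑ s, ∑ a, G s a := by
  have hf : Function.Involutive fun p : (Fin C.wires → Bool) × (Fin l → Bool) =>
      (C.setOutBits p.1 p.2, C.outBits p.1) := fun p =>
    Prod.ext (C.setOutBits_setOutBits_outBits p.1 p.2) (C.outBits_setOutBits p.1 p.2)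
  have := Equiv.sum_comp (Function.Involutive.toPerm _ hf) fun p => G p.1 p.2
  rw [Fintype.sum_prod_type, Fintype.sum_prod_type] at this
  exact this

/-- The diagonal terms sum to `tr ρ`, because the generator's amplitudes have norm one; the cross
terms sum to `tr (ρ_b ρ)`, because tracing out the discarded wires yields `ρ_b`. Each kind occurs
twice, the two copies being related by the swap, which turns `/ 4` into `/ 2`. -/
theorem acceptProb_swapTest (b : Bool) (ρ : Matrix (Fin l → Bool) (Fin l → Bool) ℂ) :
    (C.swapTest b).acceptProb ρ =
      ((ρ.trace - (C.run (basisState b) * ρ).trace) / 2).re := by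
  rw [acceptProb_swapTest_eq_sum]
  congr 1
  let v (s : Fin C.wires → Bool) : ℂ := C.iso s fun _ => b
  let F (s : Fin C.wires → Bool) (a : Fin l → Bool) : ℂ := v s * star (v s) * ρ a a
  let G (s : Fin C.wires → Bool) (a : Fin l → Bool) : ℂ :=
    v s * star (v (C.setOutBits s a)) * ρ a (C.outBits s)
  have hF : ∑ s, ∑ a, F s a = ρ.trace := by
    simp only [F, ← Finset.mul_sum, ← Finset.sum_mul]
    rw [C.sum_iso_mul_star fun _ => b, one_mul]
    rfl
  have hG : ∑ s, ∑ a, G s a = (C.run (basisState b) * ρ).trace := by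
    simp only [trace, diag_apply, mul_apply, run_basisState, Finset.sum_mul, ite_mul, zero_mul]
    refine Finset.sum_comm.trans (Eq.trans ?_ Finset.sum_comm)
    refine Finset.sum_congr rfl fun a' _ => ?_
    rw [Finset.sum_comm]
    refine Finset.sum_congr rfl fun s _ => ?_
    rw [Finset.sum_ite_eq, if_pos (Finset.mem_univ _)]
  have h (s : Fin C.wires → Bool) (a : Fin l → Bool) :
      ∑ a₁, ∑ a₂, C.amplitude b a₁ s a * ρ a₁ a₂ * star (C.amplitude b a₂ s a) =
        ((F s a + F (C.setOutBits s a) (C.outBits s)) -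
          (G s a + G (C.setOutBits s a) (C.outBits s))) / 4 := by
    simp only [F, G, setOutBits_setOutBits_outBits, outBits_setOutBits]
    exact sum_sum_single_sub_single ρ a (C.outBits s) (v s) (v (C.setOutBits s a))
  simp only [h, ← Finset.sum_div, Finset.sum_sub_distrib, Finset.sum_add_distrib,
    C.sum_comp_exchange_out, hF, hG]
  ring

/-! ### The description of the swap test -/

theorem encode_eq_generatorString :
    C.encode = generatorString (C.wires, l, C.gates.flatMap Gate.encode) := by
  simp [encode, generatorString]

/-- The description of `inputGates`. -/
def inputString (b : Bool) : List Sym :=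
  if b then [.h, .sep, .t, .sep, .t, .sep, .t, .sep, .t, .sep, .h, .sep] else []

/-- The generator's wires come first and keep their numbers, so its gate descriptions are copied
verbatim; this spares the program any renumbering. -/
theorem flatMap_encode_map_genWire {w : ℕ} (gs : List (Gate (Fin w))) :
    (gs.map (Gate.map (genWire : Fin w → Fin (w + 1 + l)) genWire_injective)).flatMap Gate.encode =
      gs.flatMap Gate.encode := by
  rw [List.flatMap_map]
  congr 1
  funext g
  cases g <;> rfl

theorem flatMap_encode_cswapGates (i : Fin l) :
    (C.cswapGates i).flatMap Gate.encode =
      cswapTokens.flatMap (Token.eval (counters C.wires 0 i)) := by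
  simp [cswapGates, cswapTokens, Gate.encode, Token.eval, counters, encodeNum, genWire, testWire,
    ancWire, List.replicate_add]

theorem flatMap_encode_swapGates (k : ℕ) (hk : k ≤ l) :
    (C.swapGates k hk).flatMap Gate.encode = swapsString C.wires k := by
  induction k with
  | zero => rfl
  | succ k ih => rw [swapGates, List.flatMap_append, ih, flatMap_encode_cswapGates, swapsString]

theorem flatMap_encode_notGates_ancWire :
    (notGates (ancWire : Fin (C.wires + 1 + l))).flatMap Gate.encode =
      xTokens.flatMap (Token.eval (counters C.wires l 0)) := by
  simp [notGates, xTokens, Gate.encode, Token.eval, counters, encodeNum, ancWire]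

theorem flatMap_encode_inputGates (b : Bool) :
    (C.inputGates b).flatMap Gate.encode = inputString b := by
  cases b
  · rfl
  · simp [inputGates, inputString, notGates, Gate.encode, encodeNum, genWire, firstWire]

theorem flatMap_encode_outGates :
    C.outGates.flatMap Gate.encode =
      outTokens.flatMap (Token.eval (counters C.wires l 0)) := by
  simp [outGates, outTokens, Gate.encode, Token.eval, counters, encodeNum, ancWire, genWire,
    firstWire]

theorem encode_swapTest (b : Bool) :
    (C.swapTest b).encode =
      swapTestString (inputString b) C.wires l (C.gates.flatMap Gate.encode) := by
  have hhead : encodeNum (C.wires + 1 + l) ++ encodeNum l ++ encodeNum 1 =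
      headTokens.flatMap (Token.eval (counters C.wires l 0)) := by
    simp [headTokens, Token.eval, counters, encodeNum, List.replicate_add]
  have hh : Gate.encode (Gate.h (ancWire : Fin (C.wires + 1 + l))) =
      hTokens.flatMap (Token.eval (counters C.wires l 0)) := by
    simp [hTokens, Gate.encode, Token.eval, counters, encodeNum, ancWire]
  have hmid : ((inputString b).map Token.sym).flatMap (Token.eval (counters C.wires l 0)) =
      inputString b := by
    rw [List.flatMap_map]
    exact List.flatMap_singleton' _
  have key : (C.loadGates ++ (C.inputGates b ++ (C.generatorGates ++
      ([Gate.h ancWire] ++ (C.swapGates l le_rfl ++ ([Gate.h ancWire] ++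
        C.outGates)))))).flatMap Gate.encode =
      xTokens.flatMap (Token.eval (counters C.wires l 0)) ++ (swapsString C.wires l ++
        xTokens.flatMap (Token.eval (counters C.wires l 0))) ++ (inputString b ++
          (C.gates.flatMap Gate.encode ++ (hTokens.flatMap (Token.eval (counters C.wires l 0)) ++
            (swapsString C.wires l ++ (hTokens.flatMap (Token.eval (counters C.wires l 0)) ++
              outTokens.flatMap (Token.eval (counters C.wires l 0))))))) := by
    simp only [loadGates, generatorGates, List.flatMap_append, List.flatMap_cons, List.flatMap_nil,
      List.append_nil, flatMap_encode_notGates_ancWire, flatMap_encode_swapGates,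
      flatMap_encode_inputGates, flatMap_encode_map_genWire, flatMap_encode_outGates, hh]
  change encodeNum (C.wires + 1 + l) ++ encodeNum l ++ encodeNum 1 ++ List.flatMap _ _ = _
  rw [hhead]
  refine (congrArg _ key).trans ?_
  simp only [swapTestString, List.flatMap_append, hmid, List.append_assoc]

end Circuit

/-- A machine sees only strings, so the output type may change as long as its encoding does not.
This passes from circuits, whose types depend on `n`, to triples of a fixed type and back. -/
theorem _root_.Turing.TM2ComputableInPolyTime.of_encode_eq {α β β' αΓ βΓ : Type}
    {eα : α → List αΓ} {eβ : β → List βΓ} {eβ' : β' → List βΓ} {f : α → β} {f' : α → β'}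
    (h : Nonempty (Turing.TM2ComputableInPolyTime eα eβ f)) (he : ∀ a, eβ (f a) = eβ' (f' a)) :
    Nonempty (Turing.TM2ComputableInPolyTime eα eβ' f') := by
  obtain ⟨h⟩ := h
  exact ⟨⟨h.toTM2ComputableAux, h.time, fun a => he a ▸ h.outputsFun a⟩⟩

/-- The adversary that performs the swap test of its input and the output of `S` on input `b`. -/
def swapAdversary {ℓ : ℕ → ℕ} (S : QPT (fun _ => 1) ℓ) (b : Bool) : QPT ℓ (fun _ => 1) where
  circuit n := (S.circuit n).swapTest b
  uniform := by
    obtain ⟨h₁⟩ := Turing.TM2ComputableInPolyTime.of_encode_eq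
      (f' := fun n => ((S.circuit n).wires, ℓ n, (S.circuit n).gates.flatMap Gate.encode))
      S.uniform fun n => (S.circuit n).encode_eq_generatorString
    obtain ⟨h₂⟩ := swapTestString_computable (Circuit.inputString b)
    exact Turing.TM2ComputableInPolyTime.of_encode_eq (h₁.comp h₂)
      fun n => ((S.circuit n).encode_swapTest b).symm

/-! ### The advantage of the adversaries -/

section Advantage

variable {ℓ : ℕ → ℕ} (S : QPT (fun _ => 1) ℓ) (n : ℕ)

/-- Both states have trace one, so the terms `tr ρ` cancel and only the overlaps with `ρ_b` remain.
-/
theorem advantage_swapAdversary (b : Bool) :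
    advantage S (swapAdversary S b) n =
      |((S.state b n * (S.state false n - S.state true n)).trace).re| / 2 := by
  have h (c : Bool) : (S.state c n).trace = 1 := (S.circuit n).trace_run_basisState c
  have h' (c : Bool) : ((swapAdversary S b).circuit n).acceptProb (S.state c n) =
      (((S.state c n).trace - (S.state b n * S.state c n).trace) / 2).re :=
    (S.circuit n).acceptProb_swapTest b (S.state c n)
  rw [advantage, h', h', h, h, Matrix.mul_sub, trace_sub, ← Complex.sub_re, ← abs_neg,
    ← Complex.neg_re, ← abs_two (α := ℝ), ← abs_div]
  congr 1
  rw [← Complex.div_ofNat_re]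
  congr 1
  ring

/-- With `Δ = ρ₀ - ρ₁` Hermitian, `tr Δ² = tr (ρ₀ Δ) - tr (ρ₁ Δ)`, and each term is at most twice an
advantage in absolute value. -/
theorem trace_conjTranspose_mul_state_sub_le :
    (((S.state false n - S.state true n)ᴴ * (S.state false n - S.state true n)).trace).re ≤
      2 * (advantage S (swapAdversary S false) n + advantage S (swapAdversary S true) n) := by
  have h (c : Bool) : (S.state c n)ᴴ = S.state c n := (S.circuit n).isHermitian_run_basisState c
  rw [advantage_swapAdversary, advantage_swapAdversary, conjTranspose_sub, h, h, Matrix.sub_mul,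
    trace_sub, Complex.sub_re]
  have h₁ := le_abs_self ((S.state false n * (S.state false n - S.state true n)).trace).re
  have h₂ := neg_abs_le ((S.state true n * (S.state false n - S.state true n)).trace).re
  linarith

open scoped ComplexOrder in
-- Cauchy–Schwarz: the square of the sum of the singular values is at most the dimension times the
-- sum of their squares, which is the trace on the right.
theorem traceDist_sq_le {κ : Type} [Fintype κ] [DecidableEq κ] (ρ σ : Matrix κ κ ℂ) :
    traceDist ρ σ ^ 2 ≤ Fintype.card κ * (((ρ - σ)ᴴ * (ρ - σ)).trace).re / 4 := by
  have hnn := fun i => (posSemidef_conjTranspose_mul_self (ρ - σ)).eigenvalues_nonneg i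
  have hsq := sq_sum_le_card_mul_sum_sq (s := Finset.univ) (f := fun i =>
    Real.sqrt ((isHermitian_conjTranspose_mul_self (ρ - σ)).eigenvalues i))
  simp only [Real.sq_sqrt (hnn _)] at hsq
  have htr := congrArg Complex.re
    (isHermitian_conjTranspose_mul_self (ρ - σ)).trace_eq_sum_eigenvalues
  have hre : (∑ i, (((isHermitian_conjTranspose_mul_self (ρ - σ)).eigenvalues i : ℝ) : ℂ)).re =
      ∑ i, (isHermitian_conjTranspose_mul_self (ρ - σ)).eigenvalues i := by
    rw [← Complex.ofReal_sum, Complex.ofReal_re]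
  rw [htr, traceDist, mul_pow]
  refine le_of_eq_of_le ?_ (div_le_div_of_nonneg_right (hsq.trans_eq ?_) (by norm_num))
  · ring
  · rw [Finset.card_univ]
    congr 1
    exact hre.symm

end Advantage

/-! ### Logarithmically many qubits: the contradiction -/

theorem eventually_two_pow_le {ℓ : ℕ → ℕ}
    (h : (fun n : ℕ => (ℓ n : ℝ)) =O[atTop] fun n : ℕ => Real.log n) :
    ∃ K : ℕ, ∀ᶠ n : ℕ in atTop, (2 : ℝ) ^ ℓ n ≤ (n : ℝ) ^ K := by
  obtain ⟨c, hc⟩ := h.bound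
  obtain ⟨K, hK⟩ := exists_nat_ge c
  refine ⟨K, ?_⟩
  filter_upwards [hc, eventually_ge_atTop 1] with n hn hn1
  have hn1' : (1 : ℝ) ≤ n := by exact_mod_cast hn1
  have hlog := Real.log_nonneg hn1'
  rw [Real.norm_natCast, Real.norm_of_nonneg hlog] at hn
  rw [← Real.exp_log (zero_lt_two' ℝ), ← Real.exp_nat_mul,
    ← Real.exp_log (zero_lt_one.trans_le hn1'), ← Real.exp_nat_mul, Real.exp_le_exp]
  have h2 : Real.log 2 ≤ 1 := (Real.log_two_lt_d9.trans (by norm_num)).le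
  calc (ℓ n : ℝ) * Real.log 2 ≤ ℓ n * 1 := by gcongr
    _ ≤ c * Real.log n := by rwa [mul_one]
    _ ≤ K * Real.log n := by gcongr

theorem not_isEFI_of_isBigO_log {ℓ : ℕ → ℕ} (S : QPT (fun _ => 1) ℓ)
    (hℓ : (fun n : ℕ => (ℓ n : ℝ)) =O[atTop] fun n : ℕ => Real.log n) : ¬ IsEFI S := by
  rintro ⟨hind, p, hp⟩
  obtain ⟨K, hK⟩ := eventually_two_pow_le hℓ
  -- Negligible functions absorb polynomial factors, so `p² n^K δ` tends to zero and is eventually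
  -- below `2`. The chain below yields `1 ≤ p² n^K · 2δ / 4`, that is `p² n^K δ ≥ 2`.
  have hlim := ((((hind (swapAdversary S false)).add (hind (swapAdversary S true))).polynomial_mul
    (p ^ 2 * .X ^ K)) 0)
  have hlt := hlim.eventually (gt_mem_nhds (zero_lt_two' ℝ))
  obtain ⟨n, hlt, hK, hp, hdist⟩ := (hlt.and (hK.and hp)).exists
  simp only [pow_zero, one_mul, Polynomial.eval_mul, Polynomial.eval_pow, Polynomial.eval_X,
    Pi.add_apply] at hlt
  set δ := advantage S (swapAdversary S false) n + advantage S (swapAdversary S true) n with hδ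
  have hδ0 : 0 ≤ δ := add_nonneg (abs_nonneg _) (abs_nonneg _)
  have hsq : (1 / p.eval (n : ℝ)) ^ 2 ≤ (2 : ℝ) ^ ℓ n * (2 * δ) / 4 := by
    refine (pow_le_pow_left₀ (by positivity) hdist 2).trans ((traceDist_sq_le _ _).trans ?_)
    have hcard : (Fintype.card (Fin (ℓ n) → Bool) : ℝ) = 2 ^ ℓ n := by simp
    rw [hcard]
    gcongr
    exact trace_conjTranspose_mul_state_sub_le S n
  have h1 : 1 ≤ p.eval (n : ℝ) ^ 2 * ((2 : ℝ) ^ ℓ n * (2 * δ) / 4) := by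
    calc 1 = p.eval (n : ℝ) ^ 2 * (1 / p.eval (n : ℝ)) ^ 2 := by field_simp
      _ ≤ _ := by gcongr
  have h2 : p.eval (n : ℝ) ^ 2 * ((2 : ℝ) ^ ℓ n * (2 * δ) / 4) ≤
      p.eval (n : ℝ) ^ 2 * ((n : ℝ) ^ K * (2 * δ) / 4) := by gcongr
  linarith

end QEFI

theorem mainTheorem8 :
    ¬ ∃ (ℓ : ℕ → ℕ) (S : QEFI.QPT (fun _ => 1) ℓ),
      (fun n : ℕ => (ℓ n : ℝ)) =O[atTop] (fun n : ℕ => Real.log n) ∧ QEFI.IsEFI S := by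
  rintro ⟨ℓ, S, hℓ, hS⟩
  exact QEFI.not_isEFI_of_isBigO_log S hℓ hS
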